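/- Let $M$ be a compact (Hausdorff, not necessarily connected) smooth manifold without boundary, and let $\eta'\in\Omega^1(M)$ be a smooth, closed, nowhere vanishing $1$-form whose cohomology class is a real multiple of an integer class, i.e. $[\eta']=r\cdot a_{\mathbb R}$ in $H^1(M;\mathbb R)$ for some $r\in\mathbb R$ and some $a\in H^1(M;\mathbb Z)$ (singular cohomology), where $a_{\mathbb R}$ is the image of $a$ in $H^1(M;\mathbb R)$ and $[\eta']$ is identified with a singular class by the de Rham isomorphism. Let $\mathcal F_{\eta'}$ be the codimension $1$ foliation defined by $\ker\eta'$; its leaves are the maximal connected integral manifolds of $\ker\eta'$, with their own manifold topology. Then every leaf of $\mathcal F_{\eta'}$ is compact. Moreover, there is a fibration $h\colon M\to S^1$ (a smooth, smoothly locally trivial fibre bundle) such that the leaves of $\mathcal F_{\eta'}$ are exactly the connected components of the fibers of $h$; if $M$ is connected, then $h$ can be chosen so that the leaves of $\mathcal F_{\eta'}$ are exactly the fibers of $h$. -/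

import Mathlib

open Set Bundle
open scoped Manifold ContDiff

universe u

noncomputable section

/-- Smooth `1`-forms on an `n`-manifold `M`: smooth sections of the cotangent bundle. -/
abbrev OneForm (n : ℕ) (M : Type*) [TopologicalSpace M]
    [ChartedSpace (EuclideanSpace ℝ (Fin n)) M] [IsManifold (𝓡 n) ∞ M] : Type _ :=
  ContMDiffSection (𝓡 n) (EuclideanSpace ℝ (Fin n) →L[ℝ] ℝ) ∞
    (fun x : M => TangentSpace (𝓡 n) x →L[ℝ] Bundle.Trivial M ℝ x)

namespace OneForm

variable {n : ℕ} {M : Type*} [TopologicalSpace M]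
  [ChartedSpace (EuclideanSpace ℝ (Fin n)) M] [IsManifold (𝓡 n) ∞ M]

/-- The value `η_x(v)`. -/
def eval (η : OneForm n M) (x : M) (v : TangentSpace (𝓡 n) x) : ℝ :=
  (η x : TangentSpace (𝓡 n) x →L[ℝ] ℝ) v

/-- The coordinate expression of `η` in the chart at `x₀`, that is, the pullback of `η` under the
inverse of the chart. -/
def inChart (η : OneForm n M) (x₀ : M) (y : EuclideanSpace ℝ (Fin n)) :
    EuclideanSpace ℝ (Fin n) →L[ℝ] ℝ :=
  (η ((extChartAt (𝓡 n) x₀).symm y) :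
      TangentSpace (𝓡 n) ((extChartAt (𝓡 n) x₀).symm y) →L[ℝ] ℝ).comp
    (mfderiv (𝓡 n) (𝓡 n) (extChartAt (𝓡 n) x₀).symm y)

/-- `dη = 0`: in every chart, `dη(v, w) = (D_v η)(w) - (D_w η)(v)` vanishes. -/
def IsClosed (η : OneForm n M) : Prop :=
  ∀ x₀ : M, ∀ y ∈ (extChartAt (𝓡 n) x₀).target, ∀ v w : EuclideanSpace ℝ (Fin n),
    fderiv ℝ (η.inChart x₀) y v w - fderiv ℝ (η.inChart x₀) y w v = 0

/-- `η_x ≠ 0` for every `x`. -/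
def IsNowhereVanishing (η : OneForm n M) : Prop :=
  ∀ x : M, ∃ v : TangentSpace (𝓡 n) x, η.eval x v ≠ 0

end OneForm

/-! ### Singular cochains -/

/-- Singular `k`-simplices in `X`. -/
abbrev SingularSimplex (k : ℕ) (X : Type*) [TopologicalSpace X] : Type _ :=
  C(stdSimplex ℝ (Fin (k + 1)), X)

namespace SingularSimplex

/-- The `i`-th face of a singular simplex. -/
def face {k : ℕ} {X : Type*} [TopologicalSpace X] (i : Fin (k + 2))
    (σ : SingularSimplex (k + 1) X) : SingularSimplex k X :=
  σ.comp ⟨stdSimplex.map i.succAbove, stdSimplex.continuous_map _⟩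

/-- The curve `t ↦ σ(1 - t, t)`, `t ∈ [0, 1]`, of a singular `1`-simplex
(extended to `ℝ` by constants). -/
def curve {X : Type*} [TopologicalSpace X] (σ : SingularSimplex 1 X) (t : ℝ) : X :=
  σ (stdSimplexHomeomorphUnitInterval.symm (projIcc 0 1 zero_le_one t))

/-- Smooth singular `1`-simplices. -/
def IsSmooth (n : ℕ) {M : Type*} [TopologicalSpace M]
    [ChartedSpace (EuclideanSpace ℝ (Fin n)) M] (σ : SingularSimplex 1 M) : Prop :=
  ContMDiffOn 𝓘(ℝ, ℝ) (𝓡 n) ∞ σ.curve (Icc 0 1)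

end SingularSimplex

/-- Singular `k`-cochains of `X` with coefficients in `A`. -/
abbrev SingularCochain (k : ℕ) (X : Type*) [TopologicalSpace X] (A : Type*) : Type _ :=
  SingularSimplex k X → A

/-- The singular coboundary `(δa)(σ) = ∑ᵢ (-1)ⁱ a(∂ᵢ σ)`. -/
def SingularCochain.coboundary {k : ℕ} {X : Type*} [TopologicalSpace X] {A : Type*}
    [AddCommGroup A] (a : SingularCochain k X A) : SingularCochain (k + 1) X A :=
  fun σ => ∑ i : Fin (k + 2), (-1 : ℤ) ^ (i : ℕ) • a (SingularSimplex.face i σ)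

namespace OneForm

variable {n : ℕ} {M : Type*} [TopologicalSpace M]
  [ChartedSpace (EuclideanSpace ℝ (Fin n)) M] [IsManifold (𝓡 n) ∞ M]

/-- `∫_σ η`, for a smooth singular `1`-simplex `σ`. -/
def integral (η : OneForm n M) (σ : SingularSimplex 1 M) : ℝ :=
  ∫ t in (0 : ℝ)..1,
    η.eval (σ.curve t) (mfderivWithin 𝓘(ℝ, ℝ) (𝓡 n) σ.curve (Icc 0 1) t (1 : ℝ))

/-- `[η] = r [a]` in `H¹(M; ℝ)` for some real number `r` and some class `[a] ∈ H¹(M; ℤ)`.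
Here `H¹(M; ℤ)` is singular cohomology, and the de Rham class of `η` is compared with the image of
the singular class by the de Rham homomorphism: the cochain `σ ↦ ∫_σ η - r a(σ)` on smooth
singular `1`-simplices is the coboundary of a real `0`-cochain `b`. -/
def IsRealMultipleOfIntegralClass (η : OneForm n M) : Prop :=
  ∃ (r : ℝ) (a : SingularCochain 1 M ℤ), a.coboundary = 0 ∧
    ∃ b : SingularCochain 0 M ℝ, ∀ σ : SingularSimplex 1 M, σ.IsSmooth n →
      η.integral σ - r * (a σ : ℝ) = b.coboundary σ

end OneForm

/-! ### The foliation `ker η` and its leaves -/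

section Leaves


variable {n : ℕ} {M : Type u} [TopologicalSpace M]
  [ChartedSpace (EuclideanSpace ℝ (Fin n)) M] [IsManifold (𝓡 n) ∞ M]

/-- `ι : N → M` is an integral manifold of the distribution `ker η`: an injective smooth immersion
whose tangent spaces are the hyperplanes `ker η`. -/
structure OneForm.IsIntegralManifold (η : OneForm n M) (N : Type u) [TopologicalSpace N]
    [ChartedSpace (EuclideanSpace ℝ (Fin (n - 1))) N] (ι : N → M) : Prop where
  contMDiff : ContMDiff (𝓡 (n - 1)) (𝓡 n) ∞ ι
  injective : Function.Injective ι
  immersion : ∀ p : N, Function.Injective (mfderiv (𝓡 (n - 1)) (𝓡 n) ι p)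
  tangent : ∀ p : N, range (mfderiv (𝓡 (n - 1)) (𝓡 n) ι p) = {v | η.eval (ι p) v = 0}

/-- `ι : N → M` is a leaf of the foliation `ker η`: a maximal connected integral manifold, with
its own (leaf) topology. -/
structure OneForm.IsLeaf (η : OneForm n M) (N : Type u) [TopologicalSpace N] [T2Space N]
    [SecondCountableTopology N] [ConnectedSpace N]
    [ChartedSpace (EuclideanSpace ℝ (Fin (n - 1))) N] [IsManifold (𝓡 (n - 1)) ∞ N]
    (ι : N → M) : Prop where
  isIntegralManifold : η.IsIntegralManifold N ι
  maximal : ∀ (N' : Type u) [TopologicalSpace N'] [T2Space N'] [SecondCountableTopology N']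
    [ConnectedSpace N'] [ChartedSpace (EuclideanSpace ℝ (Fin (n - 1))) N']
    [IsManifold (𝓡 (n - 1)) ∞ N'] (ι' : N' → M),
    η.IsIntegralManifold N' ι' → range ι ⊆ range ι' → range ι' = range ι

/-- The subset `S` of `M` is (the underlying set of) a leaf of the foliation `ker η`. -/
def OneForm.IsLeafSet (η : OneForm n M) (S : Set M) : Prop :=
  ∃ (N : Type u) (_ : TopologicalSpace N) (_ : T2Space N) (_ : SecondCountableTopology N)
    (_ : ConnectedSpace N) (_ : ChartedSpace (EuclideanSpace ℝ (Fin (n - 1))) N)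
    (_ : IsManifold (𝓡 (n - 1)) ∞ N) (ι : N → M), η.IsLeaf N ι ∧ range ι = S

/-- `h : M → S¹` is a smooth fibration: a smooth map that is a smoothly locally trivial fibre
bundle, whose typical fibre `F` is a smooth manifold. -/
def IsSmoothCircleFibration (n : ℕ) {M : Type u} [TopologicalSpace M]
    [ChartedSpace (EuclideanSpace ℝ (Fin n)) M] (h : M → Circle) : Prop :=
  ContMDiff (𝓡 n) (𝓡 1) ∞ h ∧
  ∃ (F : Type u) (_ : TopologicalSpace F) (_ : ChartedSpace (EuclideanSpace ℝ (Fin (n - 1))) F)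
    (_ : IsManifold (𝓡 (n - 1)) ∞ F),
    ∀ z : Circle, ∃ e : Trivialization F h, z ∈ e.baseSet ∧
      ContMDiffOn (𝓡 n) ((𝓡 1).prod (𝓡 (n - 1))) ∞ e e.source ∧
      ContMDiffOn ((𝓡 1).prod (𝓡 (n - 1))) (𝓡 n) ∞ e.toOpenPartialHomeomorph.symm e.target

end Leaves

end

/-!
Suppose `η - r a = δb` on smooth singular `1`-simplices, with `a` an integral cocycle. Along a short
smooth path, `b` changes by `∫ η` up to a multiple of `r`; so if `f` is a local primitive of `η`,
then `b - f` takes values in a coset of `r ℤ`. Here `r ≠ 0`, as otherwise `b` would be a global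
primitive of `η`, which has a critical point because `M` is compact. Hence `h = exp (2 π i b / r)` is
a smooth map to the circle which locally has the form `exp (i g)`, where `dg` has the same kernel as
`η`. Such a map is called a *phase* of `η` below (`OneForm.exists_isPhase`); it is a submersion whose
fibres are tangent to `ker η`.

*Leaves.* Every point has a foliated chart in `ℝⁿ⁻¹ × ℝ`, in which `ker η` is the kernel of the
differential of the last coordinate and `h` is the exponential of that coordinate
(`OneForm.IsPhase.exists_isFoliatedChart`). A phase is constant on every connected integral manifold,
and every component of a fibre is an integral manifold. So the leaves are exactly the components of
the fibres of `h` (`OneForm.IsPhase.isLeafSet_iff`), and since an integral manifold is open in the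
fibre containing it, they carry the subspace topology and are compact (`OneForm.IsLeaf.compactSpace`).

*Fibration.* Local triviality of `h` is the compact case of Ehresmann's theorem. In place of flows,
the proof uses a smooth retraction `ρ` of a neighbourhood of a fibre onto this fibre, assembled from
shifts in foliated charts by means of a partition of unity (`OneForm.IsPhase.exists_retraction`). The
map `(h, ρ)` is a local diffeomorphism along the fibre and injective on it, so by compactness it is a
trivialization near the fibre (`OneForm.IsPhase.exists_trivialization`).

*Connected fibres.* If `M` is connected, then the space of components of fibres of `h` is a compact
connected covering space of the circle, hence a circle. Rescaling its coordinate turns the projection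
from `M` to it into a phase whose fibres are connected (`OneForm.IsPhase.exists_isConnected_fiber`),
and then the leaves are the fibres.
-/

noncomputable section

set_option linter.unusedSectionVars false

/-! ### Local primitives of closed forms -/

section Primitive

variable {n : ℕ} {M : Type*} [TopologicalSpace M]
  [ChartedSpace (EuclideanSpace ℝ (Fin n)) M] [IsManifold (𝓡 n) ∞ M]

open Filter Topology

lemma extChartAt_symm_mdifferentiableAt {x₀ : M} {y : EuclideanSpace ℝ (Fin n)}
    (hy : y ∈ (extChartAt (𝓡 n) x₀).target) :
    MDifferentiableAt (𝓡 n) (𝓡 n) (extChartAt (𝓡 n) x₀).symm y :=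
  ((contMDiffOn_extChartAt_symm (n := ∞) x₀).contMDiffAt
    ((isOpen_extChartAt_target x₀).mem_nhds hy)).mdifferentiableAt (by simp)

lemma extChartAt_mdifferentiableAt {x₀ x : M} (hx : x ∈ (extChartAt (𝓡 n) x₀).source) :
    MDifferentiableAt (𝓡 n) (𝓡 n) (extChartAt (𝓡 n) x₀) x :=
  (contMDiffAt_extChartAt' (n := ∞) (by simpa using hx)).mdifferentiableAt (by simp)

/-- The coordinate expression of a smooth `1`-form is smooth. -/
lemma OneForm.contDiffOn_inChart (η : OneForm n M) (x₀ : M) :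
    ContDiffOn ℝ ∞ (η.inChart x₀) (extChartAt (𝓡 n) x₀).target := by
  have h1 : ContMDiffOn (𝓡 n) 𝓘(ℝ, EuclideanSpace ℝ (Fin n) →L[ℝ] ℝ) ∞
      (fun x => ContinuousLinearMap.inCoordinates (EuclideanSpace ℝ (Fin n))
        (TangentSpace (𝓡 n)) ℝ (Bundle.Trivial M ℝ) x₀ x x₀ x (η x))
      (extChartAt (𝓡 n) x₀).source := by
    intro x hx
    have hx' : x ∈ (chartAt (EuclideanSpace ℝ (Fin n)) x₀).source := by simpa using hx
    have h := (Bundle.Trivialization.contMDiffAt_section_iff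
      (trivializationAt (EuclideanSpace ℝ (Fin n) →L[ℝ] ℝ)
        (fun x : M => TangentSpace (𝓡 n) x →L[ℝ] Bundle.Trivial M ℝ x) x₀)
      (x₀ := x) (IB := 𝓡 n) (by simpa using hx')).1 η.contMDiff.contMDiffAt
    exact h.contMDiffWithinAt
  have h2 := h1.comp (contMDiffOn_extChartAt_symm (n := ∞) (I := 𝓡 n) x₀)
    (fun y hy => (extChartAt (𝓡 n) x₀).map_target hy)
  rw [← contMDiffOn_iff_contDiffOn]
  refine h2.congr fun y hy => ?_
  have hs : (extChartAt (𝓡 n) x₀).symm y ∈ (chartAt (EuclideanSpace ℝ (Fin n)) x₀).source := by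
    simpa using (extChartAt (𝓡 n) x₀).map_target hy
  ext v
  simp only [OneForm.inChart, Function.comp_def, ContinuousLinearMap.inCoordinates]
  rw [TangentBundle.symmL_trivializationAt hs]
  rw [(extChartAt (𝓡 n) x₀).right_inv hy]
  simp [mfderivWithin_univ]

lemma OneForm.inChart_apply_mfderiv (η : OneForm n M) {x₀ x : M}
    (hx : x ∈ (extChartAt (𝓡 n) x₀).source) (v : TangentSpace (𝓡 n) x) :
    η.inChart x₀ (extChartAt (𝓡 n) x₀ x) (mfderiv (𝓡 n) (𝓡 n) (extChartAt (𝓡 n) x₀) x v) =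
      η.eval x v := by
  have h2 := mfderiv_comp_of_eq (x := x) (g := (extChartAt (𝓡 n) x₀).symm)
    (f := extChartAt (𝓡 n) x₀)
    (extChartAt_symm_mdifferentiableAt ((extChartAt (𝓡 n) x₀).map_source hx))
    (extChartAt_mdifferentiableAt hx) rfl
  have h3 : ((extChartAt (𝓡 n) x₀).symm ∘ extChartAt (𝓡 n) x₀) =ᶠ[𝓝 x] id := by
    filter_upwards [(isOpen_extChartAt_source (I := 𝓡 n) x₀).mem_nhds hx] with y hy
    exact (extChartAt (𝓡 n) x₀).left_inv hy
  rw [h3.mfderiv_eq, mfderiv_id] at h2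
  have h4 := DFunLike.congr_fun h2 v
  have h5 : ∀ (x' : M) (w : EuclideanSpace ℝ (Fin n)), x' = x → w = v →
      η.eval x' w = η.eval x v := by
    rintro x' w rfl rfl; rfl
  exact h5 _ _ ((extChartAt (𝓡 n) x₀).left_inv hx) h4.symm

lemma OneForm.hasMFDerivAt_comp_extChartAt (η : OneForm n M) {x₀ x : M}
    (hx : x ∈ (extChartAt (𝓡 n) x₀).source) {g : EuclideanSpace ℝ (Fin n) → ℝ}
    (hg : HasFDerivAt g (η.inChart x₀ (extChartAt (𝓡 n) x₀ x)) (extChartAt (𝓡 n) x₀ x)) :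
    HasMFDerivAt (𝓡 n) 𝓘(ℝ, ℝ) (g ∘ extChartAt (𝓡 n) x₀) x
      (η x : TangentSpace (𝓡 n) x →L[ℝ] ℝ) := by
  have h := hg.hasMFDerivAt.comp x (extChartAt_mdifferentiableAt hx).hasMFDerivAt
  have h' : (η x : TangentSpace (𝓡 n) x →L[ℝ] ℝ) =
      (η.inChart x₀ (extChartAt (𝓡 n) x₀ x)).comp
        (mfderiv (𝓡 n) (𝓡 n) (extChartAt (𝓡 n) x₀) x) := by
    ext v
    exact (η.inChart_apply_mfderiv hx v).symm
  rw [h']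
  exact h

/-- **Local primitives.** A closed `1`-form has a smooth primitive on a ball in each chart. -/
lemma OneForm.exists_primitive_inChart (η : OneForm n M) (hη : η.IsClosed) (x₀ : M) :
    ∃ r > 0, Metric.ball (extChartAt (𝓡 n) x₀ x₀) r ⊆ (extChartAt (𝓡 n) x₀).target ∧
      ∃ g : EuclideanSpace ℝ (Fin n) → ℝ,
        ContDiffOn ℝ ∞ g (Metric.ball (extChartAt (𝓡 n) x₀ x₀) r) ∧
        ∀ y ∈ Metric.ball (extChartAt (𝓡 n) x₀ x₀) r, HasFDerivAt g (η.inChart x₀ y) y := by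
  obtain ⟨r, hr, hsub⟩ := Metric.mem_nhds_iff.1
    ((isOpen_extChartAt_target (I := 𝓡 n) x₀).mem_nhds (mem_extChartAt_target x₀))
  have hω := (η.contDiffOn_inChart x₀).mono hsub
  obtain ⟨g, hg⟩ := (convex_ball (extChartAt (𝓡 n) x₀ x₀) r).exists_forall_hasFDerivAt_of_fderiv_symmetric
    Metric.isOpen_ball (hω.differentiableOn (by simp))
    (fun y hy v w => sub_eq_zero.1 (hη x₀ y (hsub hy) v w))
  refine ⟨r, hr, hsub, g, ?_, hg⟩
  exact (contDiffOn_infty_iff_fderiv_of_isOpen Metric.isOpen_ball).2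
    ⟨fun y hy => (hg y hy).differentiableAt.differentiableWithinAt,
      hω.congr fun y hy => (hg y hy).fderiv⟩

end Primitive

/-! ### Integrals over smooth singular simplices -/

section Simplex

lemma SingularSimplex.face_eq_const {X : Type*} [TopologicalSpace X] (σ : SingularSimplex 1 X)
    (i : Fin 2) :
    SingularSimplex.face i σ = ContinuousMap.const _ (σ (stdSimplex.vertex (i.succAbove 0))) := by
  ext p
  rw [Subsingleton.elim p (stdSimplex.vertex 0)]
  simp [SingularSimplex.face]

lemma SingularSimplex.curve_zero {X : Type*} [TopologicalSpace X] (σ : SingularSimplex 1 X) :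
    σ.curve 0 = σ (stdSimplex.vertex 0) := by
  have : stdSimplexHomeomorphUnitInterval.symm 0 = stdSimplex.vertex (S := ℝ) (0 : Fin 2) :=
    (Homeomorph.symm_apply_eq _).2 rfl
  rw [← this, SingularSimplex.curve, projIcc_left]
  rfl

lemma SingularSimplex.curve_one {X : Type*} [TopologicalSpace X] (σ : SingularSimplex 1 X) :
    σ.curve 1 = σ (stdSimplex.vertex 1) := by
  have : stdSimplexHomeomorphUnitInterval.symm 1 = stdSimplex.vertex (S := ℝ) (1 : Fin 2) :=
    (Homeomorph.symm_apply_eq _).2 rfl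
  rw [← this, SingularSimplex.curve, projIcc_right]
  rfl

lemma SingularCochain.coboundary_zero_apply {X : Type*} [TopologicalSpace X]
    (b : SingularCochain 0 X ℝ) (σ : SingularSimplex 1 X) :
    b.coboundary σ =
      b (ContinuousMap.const _ (σ.curve 1)) - b (ContinuousMap.const _ (σ.curve 0)) := by
  simp [SingularCochain.coboundary, Fin.sum_univ_two, σ.curve_zero, σ.curve_one,
    SingularSimplex.face_eq_const, sub_eq_add_neg]

variable {n : ℕ} {M : Type*} [TopologicalSpace M]
  [ChartedSpace (EuclideanSpace ℝ (Fin n)) M] [IsManifold (𝓡 n) ∞ M]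

lemma OneForm.eval_congr (η : OneForm n M) {x x' : M} {v v' : EuclideanSpace ℝ (Fin n)}
    (hx : x = x') (hv : v = v') : η.eval x v = η.eval x' v' := by
  subst hx hv; rfl

/-- Along a straight segment in a chart, the integral of `η` is the increment of a primitive. -/
lemma OneForm.exists_simplex_integral_eq_sub (η : OneForm n M) {x₀ : M} {r : ℝ}
    (hsub : Metric.ball (extChartAt (𝓡 n) x₀ x₀) r ⊆ (extChartAt (𝓡 n) x₀).target)
    {g : EuclideanSpace ℝ (Fin n) → ℝ}
    (hg : ∀ y ∈ Metric.ball (extChartAt (𝓡 n) x₀ x₀) r, HasFDerivAt g (η.inChart x₀ y) y)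
    {y : EuclideanSpace ℝ (Fin n)} (hy : y ∈ Metric.ball (extChartAt (𝓡 n) x₀ x₀) r) :
    ∃ σ : SingularSimplex 1 M, σ.IsSmooth n ∧ σ.curve 0 = x₀ ∧
      σ.curve 1 = (extChartAt (𝓡 n) x₀).symm y ∧
      η.integral σ = g y - g (extChartAt (𝓡 n) x₀ x₀) := by
  set φ := extChartAt (𝓡 n) x₀ with hφ
  set p := φ x₀ with hp
  have hr : 0 < r := dist_nonneg.trans_lt hy
  let c : ℝ → EuclideanSpace ℝ (Fin n) := fun t => p + t • (y - p)
  have hc : ∀ t ∈ Icc (0 : ℝ) 1, c t ∈ Metric.ball p r := fun t ht =>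
    (convex_ball p r).add_smul_sub_mem (Metric.mem_ball_self hr) hy ht
  have hcd : ∀ t, HasDerivAt c (y - p) t := fun t => by
    simpa [c] using ((hasDerivAt_id t).smul_const (y - p)).const_add p
  have hcs : ContDiff ℝ ∞ c := by fun_prop
  let σ : SingularSimplex 1 M := ⟨fun q => φ.symm (c (stdSimplexHomeomorphUnitInterval q)), by
    refine (continuousOn_extChartAt_symm x₀).comp_continuous (by fun_prop) fun q => ?_
    exact hsub (hc _ (stdSimplexHomeomorphUnitInterval q).2)⟩
  have hσ : ∀ t ∈ Icc (0 : ℝ) 1, σ.curve t = φ.symm (c t) := fun t ht => by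
    simp [SingularSimplex.curve, σ, projIcc_of_mem _ ht]
  have hsm : ∀ y ∈ Metric.ball p r, ContMDiffAt (𝓡 n) (𝓡 n) ∞ φ.symm y := fun y hy =>
    (contMDiffOn_extChartAt_symm (n := ∞) x₀).contMDiffAt
      ((isOpen_extChartAt_target x₀).mem_nhds (hsub hy))
  refine ⟨σ, ?_, ?_, ?_, ?_⟩
  · refine ContMDiffOn.congr (f := fun t => φ.symm (c t)) ?_ hσ
    intro t ht
    exact ((hsm _ (hc t ht)).comp t hcs.contMDiff.contMDiffAt).contMDiffWithinAt
  · rw [hσ 0 (by simp)]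
    simp [c, p, φ]
  · rw [hσ 1 (by simp)]
    simp [c]
  · have h1 : ∀ t ∈ Icc (0 : ℝ) 1, HasDerivAt (g ∘ c) (η.inChart x₀ (c t) (y - p)) t :=
      fun t ht => (hg _ (hc t ht)).comp_hasDerivAt t (hcd t)
    have h2 : ∀ t ∈ Icc (0 : ℝ) 1, η.eval (σ.curve t)
        (mfderivWithin 𝓘(ℝ, ℝ) (𝓡 n) σ.curve (Icc 0 1) t (1 : ℝ)) =
        η.inChart x₀ (c t) (y - p) := by
      intro t ht
      have hu : UniqueMDiffWithinAt 𝓘(ℝ, ℝ) (Icc (0 : ℝ) 1) t :=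
        (uniqueDiffOn_Icc zero_lt_one t ht).uniqueMDiffWithinAt
      have h3 : HasMFDerivAt 𝓘(ℝ, ℝ) (𝓡 n) (φ.symm ∘ c) t _ :=
        ((hsm _ (hc t ht)).mdifferentiableAt (by simp)).hasMFDerivAt.comp t
          (hcd t).hasFDerivAt.hasMFDerivAt
      have h4 := (h3.hasMFDerivWithinAt.congr_of_eventuallyEq (s := Icc 0 1)
        (Filter.eventually_of_mem self_mem_nhdsWithin hσ) (hσ t ht)).mfderivWithin hu
      rw [h4]
      refine η.eval_congr (hσ t ht) ?_
      exact congrArg (mfderiv (𝓡 n) (𝓡 n) φ.symm (c t)) (one_smul ℝ (y - p))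
    rw [OneForm.integral, intervalIntegral.integral_congr (g := fun t => η.inChart x₀ (c t) (y - p))]
    · rw [intervalIntegral.integral_eq_sub_of_hasDerivAt (f := g ∘ c)]
      · simp [c]
      · simpa using h1
      · apply ContinuousOn.intervalIntegrable
        rw [uIcc_of_le zero_le_one]
        exact ((((η.contDiffOn_inChart x₀).continuousOn.mono hsub).comp
          hcs.continuous.continuousOn hc).clm_apply continuousOn_const)
    · simpa [EqOn] using h2

end Simplex

/-! ### The phase of a form in a multiple of an integral class -/

section Phase

open Filter Topology

variable {n : ℕ} {M : Type*} [TopologicalSpace M]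
  [ChartedSpace (EuclideanSpace ℝ (Fin n)) M] [IsManifold (𝓡 n) ∞ M]

/-- A closed `1`-form has a primitive `f` near each point `x₀`, and `f y - f x₀` is the integral of
the form along a smooth singular simplex from `x₀` to `y`. -/
lemma OneForm.exists_local_primitive (η : OneForm n M) (hη : η.IsClosed) (x₀ : M) :
    ∃ f : M → ℝ, ∀ᶠ y in 𝓝 x₀, ContMDiffAt (𝓡 n) 𝓘(ℝ, ℝ) ∞ f y ∧
      HasMFDerivAt (𝓡 n) 𝓘(ℝ, ℝ) f y (η y : TangentSpace (𝓡 n) y →L[ℝ] ℝ) ∧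
      ∃ σ : SingularSimplex 1 M, σ.IsSmooth n ∧ σ.curve 0 = x₀ ∧ σ.curve 1 = y ∧
        η.integral σ = f y - f x₀ := by
  obtain ⟨r, hr, hsub, g, hgc, hg⟩ := η.exists_primitive_inChart hη x₀
  refine ⟨g ∘ extChartAt (𝓡 n) x₀, ?_⟩
  filter_upwards [(isOpen_extChartAt_source (I := 𝓡 n) x₀).mem_nhds (mem_extChartAt_source x₀),
    (continuousAt_extChartAt (I := 𝓡 n) x₀).preimage_mem_nhds (Metric.ball_mem_nhds _ hr)]
    with y hy hyr
  refine ⟨?_, η.hasMFDerivAt_comp_extChartAt hy (hg _ hyr), ?_⟩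
  · exact (hgc.contDiffAt (Metric.isOpen_ball.mem_nhds hyr)).contMDiffAt.comp y
      (contMDiffAt_extChartAt' (by simpa using hy))
  · obtain ⟨σ, h1, h2, h3, h4⟩ := η.exists_simplex_integral_eq_sub hsub hg hyr
    exact ⟨σ, h1, h2, h3.trans ((extChartAt (𝓡 n) x₀).left_inv hy), h4⟩

/-- `h : M → S¹` is a *phase* of `η` if locally `h = exp (i f)` for a smooth real function `f`
whose differential has the same kernel as `η`. -/
def OneForm.IsPhase (η : OneForm n M) (h : M → Circle) : Prop :=
  ∀ x : M, ∃ f : M → ℝ, ∀ᶠ y in 𝓝 x, ContMDiffAt (𝓡 n) 𝓘(ℝ, ℝ) ∞ f y ∧ h y = Circle.exp (f y) ∧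
    ∀ v : TangentSpace (𝓡 n) y, η.eval y v = 0 ↔ mfderiv (𝓡 n) 𝓘(ℝ, ℝ) f y v = 0

lemma HasMFDerivAt.const_mul_add_const {f : M → ℝ} {x : M}
    {f' : TangentSpace (𝓡 n) x →L[ℝ] ℝ} (h : HasMFDerivAt (𝓡 n) 𝓘(ℝ, ℝ) f x f') (a c : ℝ)
    (v : TangentSpace (𝓡 n) x) :
    mfderiv (𝓡 n) 𝓘(ℝ, ℝ) (fun y => a * (f y + c)) x v = a * f' v := by
  have h1 : HasFDerivAt (fun t : ℝ => a * (t + c)) (a • ContinuousLinearMap.id ℝ ℝ) (f x) :=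
    ((hasFDerivAt_id (f x)).add_const c).const_mul a
  have h2 : HasMFDerivAt (𝓡 n) 𝓘(ℝ, ℝ) (fun y => a * (f y + c)) x _ :=
    h1.hasMFDerivAt.comp x h
  rw [h2.mfderiv]
  rfl

lemma IsLocalMax.hasMFDerivAt_eq_zero {f : M → ℝ} {x : M} (hf : IsLocalMax f x)
    {f' : TangentSpace (𝓡 n) x →L[ℝ] ℝ} (h : HasMFDerivAt (𝓡 n) 𝓘(ℝ, ℝ) f x f') : f' = 0 := by
  have h2 : HasFDerivAt (𝕜 := ℝ) (E := EuclideanSpace ℝ (Fin n)) (F := ℝ)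
      (writtenInExtChartAt (𝓡 n) 𝓘(ℝ, ℝ) x f) f' (extChartAt (𝓡 n) x x) :=
    HasFDerivWithinAt.hasFDerivAt h.2 (by simp)
  refine IsLocalMax.hasFDerivAt_eq_zero ?_ h2
  have h3 : Tendsto (extChartAt (𝓡 n) x).symm (𝓝 (extChartAt (𝓡 n) x x)) (𝓝 x) := by
    have := continuousAt_extChartAt_symm (I := 𝓡 n) x
    rwa [ContinuousAt, extChartAt_to_inv] at this
  filter_upwards [h3.eventually hf] with y hy
  change f ((extChartAt (𝓡 n) x).symm y) ≤ f ((extChartAt (𝓡 n) x).symm (extChartAt (𝓡 n) x x))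
  rwa [extChartAt_to_inv]

/-- A `1`-form in a real multiple of an integral class has a phase: if `η - r a` is the coboundary
of `b` on smooth simplices, then `exp (2 π i b / r)` is one. The number `r` cannot vanish, since
otherwise `b` would be a primitive of `η` on the compact manifold `M`. -/
theorem OneForm.exists_isPhase [CompactSpace M] [Nonempty M] (η : OneForm n M)
    (hη : η.IsClosed) (hvanish : η.IsNowhereVanishing) (hint : η.IsRealMultipleOfIntegralClass) :
    ∃ h : M → Circle, η.IsPhase h := by
  obtain ⟨r, a, -, b, hb⟩ := hint
  set b₀ : M → ℝ := fun x => b (ContinuousMap.const _ x) with hb₀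
  have key : ∀ x₀ : M, ∃ f : M → ℝ, ∀ᶠ y in 𝓝 x₀, ContMDiffAt (𝓡 n) 𝓘(ℝ, ℝ) ∞ f y ∧
      HasMFDerivAt (𝓡 n) 𝓘(ℝ, ℝ) f y (η y : TangentSpace (𝓡 n) y →L[ℝ] ℝ) ∧
      ∃ k : ℤ, b₀ y = b₀ x₀ + (f y - f x₀) - r * k := by
    intro x₀
    obtain ⟨f, hf⟩ := η.exists_local_primitive hη x₀
    refine ⟨f, hf.mono ?_⟩
    rintro y ⟨h1, h2, σ, hs, h3, h4, h5⟩
    refine ⟨h1, h2, a σ, ?_⟩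
    have := hb σ hs
    rw [SingularCochain.coboundary_zero_apply, h3, h4, h5] at this
    simp only [hb₀]
    linarith
  have hr : r ≠ 0 := by
    rintro rfl
    have hcont : Continuous b₀ := by
      refine continuous_iff_continuousAt.2 fun x₀ => ?_
      obtain ⟨f, hf⟩ := key x₀
      have h1 : ContinuousAt (fun y => b₀ x₀ + (f y - f x₀)) x₀ :=
        continuousAt_const.add (hf.self_of_nhds.1.continuousAt.sub continuousAt_const)
      refine h1.congr (hf.mono ?_)
      rintro y ⟨-, -, k, hk⟩
      simp [hk]
    obtain ⟨x, -, hx⟩ := isCompact_univ.exists_isMaxOn univ_nonempty hcont.continuousOn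
    obtain ⟨f, hf⟩ := key x
    have hmax : IsLocalMax f x := by
      filter_upwards [hf] with y hy
      obtain ⟨-, -, k, hk⟩ := hy
      have : b₀ y ≤ b₀ x := hx (mem_univ y)
      simp only [zero_mul, sub_zero] at hk
      linarith
    obtain ⟨v, hv⟩ := hvanish x
    apply hv
    rw [OneForm.eval, hmax.hasMFDerivAt_eq_zero hf.self_of_nhds.2.1]
    rfl
  refine ⟨fun x => Circle.exp (2 * Real.pi / r * b₀ x), fun x₀ => ?_⟩
  obtain ⟨f, hf⟩ := key x₀
  refine ⟨fun y => 2 * Real.pi / r * (f y + (b₀ x₀ - f x₀)), ?_⟩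
  filter_upwards [hf] with y hy
  obtain ⟨h1, h2, k, hk⟩ := hy
  refine ⟨?_, ?_, fun v => ?_⟩
  · exact contMDiffAt_const.mul (h1.add contMDiffAt_const)
  · rw [hk]
    have : 2 * Real.pi / r * (b₀ x₀ + (f y - f x₀) - r * k) =
        2 * Real.pi / r * (f y + (b₀ x₀ - f x₀)) - k * (2 * Real.pi) := by
      field_simp
      ring
    rw [this]
    exact Circle.periodic_exp.sub_int_mul_eq k
  · have hne : 2 * Real.pi / r ≠ 0 := by simp [hr, Real.pi_ne_zero]
    rw [h2.const_mul_add_const]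
    exact (mul_eq_zero_iff_left hne).symm

end Phase

/-! ### Inverse functions and linear algebra -/

section InverseFunction

open Filter Topology

/-- **Inverse function theorem**, smooth on a neighbourhood: a smooth map with invertible
differential at `a` restricts to a diffeomorphism between open sets. -/
lemma exists_openPartialHomeomorph_of_hasFDerivAt {E F : Type*} [NormedAddCommGroup E]
    [NormedSpace ℝ E] [CompleteSpace E] [NormedAddCommGroup F] [NormedSpace ℝ F]
    {f : E → F} {O : Set E} (hO : IsOpen O) (hf : ContDiffOn ℝ ∞ f O) {a : E} (ha : a ∈ O)
    {f' : E ≃L[ℝ] F} (hf' : HasFDerivAt f (f' : E →L[ℝ] F) a) :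
    ∃ Θ : OpenPartialHomeomorph E F, a ∈ Θ.source ∧ Θ.source ⊆ O ∧ (∀ x, Θ x = f x) ∧
      ContDiffOn ℝ ∞ Θ.symm Θ.target := by
  have hfa : ContDiffAt ℝ ∞ f a := hf.contDiffAt (hO.mem_nhds ha)
  let Θ₀ := hfa.toOpenPartialHomeomorph f hf' (by simp)
  let V : Set E := O ∩ fderiv ℝ f ⁻¹' range ((↑) : (E ≃L[ℝ] F) → E →L[ℝ] F)
  have hV : IsOpen V := (hf.continuousOn_fderiv_of_isOpen hO (by simp)).isOpen_inter_preimage hO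
    ContinuousLinearEquiv.isOpen
  have haV : a ∈ V := ⟨ha, f', hf'.fderiv.symm⟩
  refine ⟨Θ₀.restrOpen V hV, ⟨hfa.mem_toOpenPartialHomeomorph_source hf' (by simp), haV⟩,
    fun x hx => hx.2.1, fun x => rfl, fun y hy => ?_⟩
  obtain ⟨⟨hyO, g, hg⟩, hy2⟩ : (Θ₀.restrOpen V hV).symm y ∈ V ∧ _ :=
    ⟨((Θ₀.restrOpen V hV).map_target hy).2, trivial⟩
  have hd := hf.contDiffAt (hO.mem_nhds hyO)
  refine (OpenPartialHomeomorph.contDiffAt_symm (Θ₀.restrOpen V hV) (f₀' := g) hy ?_ hd).contDiffWithinAt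
  rw [hg]
  exact (hd.differentiableAt (by simp)).hasFDerivAt

/-- A nonzero functional is the second coordinate of a linear isomorphism `ℝⁿ ≃ ℝⁿ⁻¹ × ℝ`. -/
lemma exists_continuousLinearEquiv_snd_eq {n : ℕ} (ℓ : EuclideanSpace ℝ (Fin n) →L[ℝ] ℝ)
    (hℓ : ℓ ≠ 0) : ∃ A : EuclideanSpace ℝ (Fin n) ≃L[ℝ] EuclideanSpace ℝ (Fin (n - 1)) × ℝ,
      ∀ v, (A v).2 = ℓ v := by
  have hsurj : Function.Surjective ℓ :=
    LinearMap.surjective (f := (ℓ : EuclideanSpace ℝ (Fin n) →ₗ[ℝ] ℝ)) (fun h =>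
      hℓ (ContinuousLinearMap.ext fun v => LinearMap.congr_fun h v))
  have hrank := LinearMap.finrank_range_add_finrank_ker (ℓ : EuclideanSpace ℝ (Fin n) →ₗ[ℝ] ℝ)
  rw [LinearMap.range_eq_top.2 hsurj, finrank_top, Module.finrank_self,
    finrank_euclideanSpace_fin] at hrank
  have hrank' : Module.finrank ℝ (LinearMap.ker (ℓ : EuclideanSpace ℝ (Fin n) →ₗ[ℝ] ℝ)) = n - 1 := by
    omega
  obtain ⟨K⟩ : Nonempty (LinearMap.ker (ℓ : EuclideanSpace ℝ (Fin n) →ₗ[ℝ] ℝ) ≃ₗ[ℝ]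
      EuclideanSpace ℝ (Fin (n - 1))) :=
    FiniteDimensional.nonempty_linearEquiv_of_finrank_eq
      (hrank'.trans finrank_euclideanSpace_fin.symm)
  obtain ⟨P, hP⟩ := (LinearMap.ker (ℓ : EuclideanSpace ℝ (Fin n) →ₗ[ℝ] ℝ)).subtype
    |>.exists_leftInverse_of_injective (Submodule.ker_subtype _)
  let T : EuclideanSpace ℝ (Fin n) →ₗ[ℝ] EuclideanSpace ℝ (Fin (n - 1)) × ℝ :=
    (K.toLinearMap ∘ₗ P).prod (ℓ : EuclideanSpace ℝ (Fin n) →ₗ[ℝ] ℝ)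
  have hT : Function.Injective T := by
    refine (injective_iff_map_eq_zero T).2 fun v hv => ?_
    obtain ⟨h1, h2⟩ := Prod.ext_iff.1 hv
    have h3 : P v = 0 := K.map_eq_zero_iff.1 h1
    have h4 := LinearMap.congr_fun hP ⟨v, h2⟩
    simp only [LinearMap.comp_apply, Submodule.subtype_apply, LinearMap.id_apply] at h4
    rw [h3] at h4
    exact (congrArg Subtype.val h4).symm
  refine ⟨(LinearMap.linearEquivOfInjective T hT ?_).toContinuousLinearEquiv, fun v => rfl⟩
  rw [Module.finrank_prod, finrank_euclideanSpace_fin, finrank_euclideanSpace_fin,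
    Module.finrank_self]
  omega

end InverseFunction

/-! ### Foliated charts -/

section FoliatedChart

open Filter Topology

variable {n : ℕ} {M : Type*} [TopologicalSpace M]
  [ChartedSpace (EuclideanSpace ℝ (Fin n)) M] [IsManifold (𝓡 n) ∞ M]

/-- A *foliated chart* for a `1`-form `η` with phase `h`: a diffeomorphism `ψ` from an open subset
of `M` onto a ball of `ℝⁿ⁻¹ × ℝ` (a product of balls) such that `h = exp (i ψ₂)` and
`ker η = ker dψ₂`. The ball has radius at most `1`, so `ψ₂` takes values in an interval on which
`exp (i ·)` is injective. -/
structure OneForm.IsFoliatedChart (η : OneForm n M) (h : M → Circle)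
    (ψ : OpenPartialHomeomorph M (EuclideanSpace ℝ (Fin (n - 1)) × ℝ)) : Prop where
  contMDiffOn : ContMDiffOn (𝓡 n) 𝓘(ℝ, EuclideanSpace ℝ (Fin (n - 1)) × ℝ) ∞ ψ ψ.source
  contMDiffOn_symm : ContMDiffOn 𝓘(ℝ, EuclideanSpace ℝ (Fin (n - 1)) × ℝ) (𝓡 n) ∞ ψ.symm ψ.target
  eq_exp : ∀ y ∈ ψ.source, h y = Circle.exp (ψ y).2
  ker : ∀ y ∈ ψ.source, ∀ v : TangentSpace (𝓡 n) y, η.eval y v = 0 ↔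
    (mfderiv (𝓡 n) 𝓘(ℝ, EuclideanSpace ℝ (Fin (n - 1)) × ℝ) ψ y v).2 = 0
  exists_ball : ∃ a ε, ε ≤ 1 ∧ ψ.target = Metric.ball a ε

/-- Every point lies in a foliated chart. -/
theorem OneForm.IsPhase.exists_isFoliatedChart {η : OneForm n M} {h : M → Circle}
    (hh : η.IsPhase h) (hvanish : η.IsNowhereVanishing) (x : M) :
    ∃ ψ, η.IsFoliatedChart h ψ ∧ x ∈ ψ.source := by
  obtain ⟨f, hf⟩ := hh x
  obtain ⟨U, hU, hUo, hxU⟩ := eventually_nhds_iff.1 hf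
  set φ := chartAt (EuclideanSpace ℝ (Fin n)) x with hφ
  have hxφ : x ∈ φ.source := mem_chart_source _ x
  have hφs : ContMDiffOn (𝓡 n) (𝓡 n) ∞ φ.symm φ.target := contMDiffOn_chart_symm
  have hφc : ContMDiffOn (𝓡 n) (𝓡 n) ∞ φ φ.source := contMDiffOn_chart
  let O := φ.target ∩ φ.symm ⁻¹' U
  have hO : IsOpen O := φ.isOpen_inter_preimage_symm hUo
  have hxO : φ x ∈ O := ⟨φ.map_source hxφ, by simpa [φ.left_inv hxφ] using hxU⟩
  have hfO : ContDiffOn ℝ ∞ (f ∘ φ.symm) O := by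
    rw [← contMDiffOn_iff_contDiffOn]
    intro y hy
    exact ((hU _ hy.2).1.comp y
      (hφs.contMDiffAt (φ.open_target.mem_nhds hy.1))).contMDiffWithinAt
  have hfd : HasFDerivAt (f ∘ φ.symm) (fderiv ℝ (f ∘ φ.symm) (φ x)) (φ x) :=
    ((hfO.contDiffAt (hO.mem_nhds hxO)).differentiableAt (by simp)).hasFDerivAt
  have hℓ : fderiv ℝ (f ∘ φ.symm) (φ x) ≠ 0 := by
    intro h0
    obtain ⟨v, hv⟩ := hvanish x
    apply hv
    rw [(hU x hxU).2.2]
    rw [h0] at hfd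
    have h1 : HasMFDerivAt (𝓡 n) 𝓘(ℝ, ℝ) ((f ∘ φ.symm) ∘ φ) x _ := hfd.hasMFDerivAt.comp x
      ((hφc.contMDiffAt (φ.open_source.mem_nhds hxφ)).mdifferentiableAt (by simp)).hasMFDerivAt
    have h2 : f =ᶠ[𝓝 x] ((f ∘ φ.symm) ∘ φ) := by
      filter_upwards [φ.open_source.mem_nhds hxφ] with y hy
      simp [φ.left_inv hy]
    rw [h2.mfderiv_eq, h1.mfderiv]
    rfl
  obtain ⟨A, hA⟩ := exists_continuousLinearEquiv_snd_eq _ hℓ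
  let H : EuclideanSpace ℝ (Fin n) → EuclideanSpace ℝ (Fin (n - 1)) × ℝ :=
    fun y => ((A y).1, f (φ.symm y))
  have hH : HasFDerivAt H (A : EuclideanSpace ℝ (Fin n) →L[ℝ] _) (φ x) := by
    have h1 := (A.hasFDerivAt (x := φ x)).fst.prodMk hfd
    have h2 : (A : EuclideanSpace ℝ (Fin n) →L[ℝ] EuclideanSpace ℝ (Fin (n - 1)) × ℝ) =
        ((ContinuousLinearMap.fst ℝ (EuclideanSpace ℝ (Fin (n - 1))) ℝ).comp
          (A : EuclideanSpace ℝ (Fin n) →L[ℝ] EuclideanSpace ℝ (Fin (n - 1)) × ℝ)).prod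
          (fderiv ℝ (f ∘ φ.symm) (φ x)) :=
      ContinuousLinearMap.ext fun v => Prod.ext rfl (hA v)
    rw [h2]
    exact h1
  have hHc : ContDiffOn ℝ ∞ H O := ContDiffOn.prodMk (by fun_prop) hfO
  obtain ⟨Θ, hxΘ, hΘO, hΘ, hΘs⟩ := exists_openPartialHomeomorph_of_hasFDerivAt hO hHc hxO hH
  have hp : H (φ x) ∈ (φ ≫ₕ Θ).target := by
    rw [← hΘ]
    exact (φ ≫ₕ Θ).map_source ⟨hxφ, hxΘ⟩
  obtain ⟨ε₀, hε₀, hball⟩ := Metric.mem_nhds_iff.1 ((φ ≫ₕ Θ).open_target.mem_nhds hp)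
  let B := Metric.ball (H (φ x)) (min ε₀ 1)
  have hB : B ⊆ (φ ≫ₕ Θ).target := (Metric.ball_subset_ball (min_le_left _ _)).trans hball
  let ψ := (φ ≫ₕ Θ) ≫ₕ OpenPartialHomeomorph.ofSet B Metric.isOpen_ball
  have hψ : ∀ y ∈ φ.source, (ψ y).2 = f y := fun y hy => by
    simp [ψ, hΘ, H, φ.left_inv hy]
  have hsource : ∀ y ∈ ψ.source, y ∈ φ.source ∧ φ y ∈ Θ.source ∧ y ∈ U := by
    intro y hy
    have h1 : y ∈ φ.source ∧ φ y ∈ Θ.source := hy.1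
    refine ⟨h1.1, h1.2, ?_⟩
    simpa [φ.left_inv h1.1] using (hΘO h1.2).2
  have htarget : ψ.target = B := by
    have : ψ.target = B ∩ (φ ≫ₕ Θ).target := by
      simp [ψ]
    rw [this, inter_eq_left.2 hB]
  have hcont : ContMDiffOn (𝓡 n) 𝓘(ℝ, EuclideanSpace ℝ (Fin (n - 1)) × ℝ) ∞ ψ ψ.source := by
    intro y hy
    obtain ⟨h1, h2, h3⟩ := hsource y hy
    have h4 : ContMDiffAt (𝓡 n) 𝓘(ℝ, EuclideanSpace ℝ (Fin (n - 1)) × ℝ) ∞ (H ∘ φ) y :=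
      (hHc.contDiffAt (hO.mem_nhds (hΘO h2))).contMDiffAt.comp y
        (hφc.contMDiffAt (φ.open_source.mem_nhds h1))
    exact (h4.congr_of_eventuallyEq (Eventually.of_forall fun z => hΘ _)).contMDiffWithinAt
  refine ⟨ψ, ⟨hcont, ?_, fun y hy => ?_, fun y hy v => ?_, H (φ x), min ε₀ 1, min_le_right _ _,
    htarget⟩, ⟨⟨hxφ, hxΘ⟩, ?_⟩⟩
  · intro y hy
    have h1 : y ∈ (φ ≫ₕ Θ).target := hB (htarget ▸ hy)
    exact ((hφs.contMDiffAt (φ.open_target.mem_nhds h1.2)).comp y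
      (hΘs.contDiffAt (Θ.open_target.mem_nhds h1.1)).contMDiffAt).contMDiffWithinAt
  · rw [hψ y (hsource y hy).1]
    exact (hU y (hsource y hy).2.2).2.1
  · rw [(hU y (hsource y hy).2.2).2.2]
    have h1 : f =ᶠ[𝓝 y] (fun z => (ψ z).2) := by
      filter_upwards [φ.open_source.mem_nhds (hsource y hy).1] with z hz
      exact (hψ z hz).symm
    have h2 : HasMFDerivAt (𝓡 n) 𝓘(ℝ, ℝ) (fun z => (ψ z).2) y _ :=
      (ContinuousLinearMap.hasMFDerivAt (ContinuousLinearMap.snd ℝ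
        (EuclideanSpace ℝ (Fin (n - 1))) ℝ)).comp y
      ((hcont.contMDiffAt (ψ.open_source.mem_nhds hy)).mdifferentiableAt (by simp)).hasMFDerivAt
    rw [h1.mfderiv_eq, h2.mfderiv]
    rfl
  · have : (φ ≫ₕ Θ) x = H (φ x) := hΘ _
    change (φ ≫ₕ Θ) x ∈ B
    rw [this]
    exact Metric.mem_ball_self (by positivity)

end FoliatedChart

/-! ### Slice sets as manifolds -/

section Slice

open Filter Topology

variable {n : ℕ} {M : Type*} [TopologicalSpace M]
  [ChartedSpace (EuclideanSpace ℝ (Fin n)) M] [IsManifold (𝓡 n) ∞ M]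
  {η : OneForm n M} {h : M → Circle}

namespace OneForm.IsFoliatedChart

variable {ψ : OpenPartialHomeomorph M (EuclideanSpace ℝ (Fin (n - 1)) × ℝ)}

lemma contMDiffAt (hψ : η.IsFoliatedChart h ψ) {x : M} (hx : x ∈ ψ.source) :
    ContMDiffAt (𝓡 n) 𝓘(ℝ, EuclideanSpace ℝ (Fin (n - 1)) × ℝ) ∞ ψ x :=
  hψ.contMDiffOn.contMDiffAt (ψ.open_source.mem_nhds hx)

lemma contMDiffAt_symm (hψ : η.IsFoliatedChart h ψ)
    {p : EuclideanSpace ℝ (Fin (n - 1)) × ℝ} (hp : p ∈ ψ.target) :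
    ContMDiffAt 𝓘(ℝ, EuclideanSpace ℝ (Fin (n - 1)) × ℝ) (𝓡 n) ∞ ψ.symm p :=
  hψ.contMDiffOn_symm.contMDiffAt (ψ.open_target.mem_nhds hp)

lemma mfderiv_injective (hψ : η.IsFoliatedChart h ψ) {x : M} (hx : x ∈ ψ.source) :
    Function.Injective (mfderiv (𝓡 n) 𝓘(ℝ, EuclideanSpace ℝ (Fin (n - 1)) × ℝ) ψ x) :=
  (OpenPartialHomeomorph.MDifferentiable.mfderiv_bijective
    ⟨hψ.contMDiffOn.mdifferentiableOn (by simp),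
      hψ.contMDiffOn_symm.mdifferentiableOn (by simp)⟩ hx).1

lemma abs_snd_sub_snd_lt (hψ : η.IsFoliatedChart h ψ) {x y : M} (hx : x ∈ ψ.source)
    (hy : y ∈ ψ.source) : |(ψ y).2 - (ψ x).2| < Real.pi := by
  obtain ⟨a, ε, hε, ht⟩ := hψ.exists_ball
  have key : ∀ z ∈ ψ.source, |(ψ z).2 - a.2| < 1 := fun z hz => by
    have h1 : ψ z ∈ Metric.ball a ε := ht ▸ ψ.map_source hz
    have h2 : dist (ψ z).2 a.2 ≤ dist (ψ z) a := le_max_right _ _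
    rw [← Real.dist_eq]
    exact (h2.trans_lt h1).trans_le hε
  have h1 := abs_lt.1 (key x hx)
  have h2 := abs_lt.1 (key y hy)
  have hpi := Real.pi_gt_three
  exact abs_lt.2 ⟨by linarith, by linarith⟩

lemma snd_eq_of_eq (hψ : η.IsFoliatedChart h ψ) {x y : M} (hx : x ∈ ψ.source) (hy : y ∈ ψ.source)
    (hxy : h x = h y) : (ψ x).2 = (ψ y).2 := by
  rw [hψ.eq_exp x hx, hψ.eq_exp y hy, Circle.exp_eq_exp] at hxy
  obtain ⟨m, hm⟩ := hxy
  have h1 := hψ.abs_snd_sub_snd_lt hy hx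
  rw [hm, add_sub_cancel_left, abs_mul, abs_of_pos Real.two_pi_pos] at h1
  have h2 : |(m : ℝ)| < 1 := by nlinarith [Real.pi_pos]
  have h3 : m = 0 := Int.abs_lt_one_iff.1 (by exact_mod_cast h2)
  simpa [h3] using hm

lemma eq_iff_snd_eq (hψ : η.IsFoliatedChart h ψ) {x y : M} (hx : x ∈ ψ.source)
    (hy : y ∈ ψ.source) : h x = h y ↔ (ψ x).2 = (ψ y).2 :=
  ⟨hψ.snd_eq_of_eq hx hy, fun hxy => by rw [hψ.eq_exp x hx, hψ.eq_exp y hy, hxy]⟩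

/-- A plaque of a foliated chart is connected. -/
lemma isPreconnected_plaque (hψ : η.IsFoliatedChart h ψ) (t : ℝ) :
    IsPreconnected {y | y ∈ ψ.source ∧ (ψ y).2 = t} := by
  obtain ⟨a, ε, hε, ht⟩ := hψ.exists_ball
  have h1 : {y | y ∈ ψ.source ∧ (ψ y).2 = t} =
      ψ.symm '' (Metric.ball a ε ∩ {p | p.2 = t}) := by
    ext y
    constructor
    · rintro ⟨hy, rfl⟩
      exact ⟨ψ y, ⟨ht ▸ ψ.map_source hy, rfl⟩, ψ.left_inv hy⟩
    · rintro ⟨p, ⟨hp, rfl⟩, rfl⟩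
      rw [← ht] at hp
      exact ⟨ψ.map_target hp, by rw [ψ.right_inv hp]⟩
  rw [h1]
  refine IsPreconnected.image (Convex.isPreconnected ?_) _
    (ψ.continuousOn_symm.mono (by rw [ht]; exact inter_subset_left))
  refine (convex_ball a ε).inter ?_
  intro p hp q hq α β _ _ hαβ
  change α * p.2 + β * q.2 = t
  rw [hp, hq, ← add_mul, hαβ, one_mul]

end OneForm.IsFoliatedChart

/-- `S ⊆ M` is a *slice set* if near each of its points it is the level set of the second coordinate
of a foliated chart. -/
def OneForm.IsSlice (η : OneForm n M) (h : M → Circle) (S : Set M) : Prop :=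
  ∀ x ∈ S, ∃ ψ, η.IsFoliatedChart h ψ ∧ x ∈ ψ.source ∧ ∀ y ∈ ψ.source, y ∈ S ↔ (ψ y).2 = (ψ x).2

variable {S : Set M}

/-- A slice set as a type, which carries the structure of a smooth `(n - 1)`-manifold. -/
def Slice (_ : η.IsSlice h S) : Type _ := S

namespace Slice

variable (hS : η.IsSlice h S)

instance : TopologicalSpace (Slice hS) := inferInstanceAs (TopologicalSpace S)

/-- The inclusion of a slice set into `M`. -/
def incl : Slice hS → M := Subtype.val

variable {hS}

/-- A point of `S` as a point of the type `Slice hS`. -/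
def mk (x : M) (hx : x ∈ S) : Slice hS := ⟨x, hx⟩

@[simp] lemma incl_mk (x : M) (hx : x ∈ S) : incl hS (mk x hx) = x := rfl

lemma isEmbedding_incl : IsEmbedding (incl hS) := IsEmbedding.subtypeVal

lemma incl_mem (p : Slice hS) : incl hS p ∈ S := Subtype.property p

variable (hS) in
lemma range_incl : range (incl hS) = S := Subtype.range_val

open Classical in
/-- The chart of a slice set given by the first coordinate of a foliated chart around `p`. -/
def chart (p : Slice hS) (ψ : OpenPartialHomeomorph M (EuclideanSpace ℝ (Fin (n - 1)) × ℝ))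
    (hψ : ∀ y ∈ ψ.source, y ∈ S ↔ (ψ y).2 = (ψ (incl hS p)).2) :
    OpenPartialHomeomorph (Slice hS) (EuclideanSpace ℝ (Fin (n - 1))) where
  toFun q := (ψ (incl hS q)).1
  invFun v := if hv : (v, (ψ (incl hS p)).2) ∈ ψ.target then
    mk (ψ.symm (v, (ψ (incl hS p)).2)) ((hψ _ (ψ.map_target hv)).2 (by rw [ψ.right_inv hv]))
    else p
  source := incl hS ⁻¹' ψ.source
  target := {v | (v, (ψ (incl hS p)).2) ∈ ψ.target}
  map_source' q hq := by
    rw [mem_ofPred_eq, ← (hψ _ hq).1 (incl_mem q)]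
    exact ψ.map_source hq
  map_target' v hv := by
    rw [mem_ofPred_eq] at hv
    rw [dif_pos hv]
    exact ψ.map_target hv
  left_inv' q hq := by
    have h1 : (ψ (incl hS q)).2 = (ψ (incl hS p)).2 := (hψ _ hq).1 (incl_mem q)
    have h2 : ((ψ (incl hS q)).1, (ψ (incl hS p)).2) = ψ (incl hS q) := by rw [← h1]
    apply isEmbedding_incl.injective
    rw [dif_pos (h2 ▸ ψ.map_source hq), incl_mk, h2, ψ.left_inv hq]
  right_inv' v hv := by
    rw [mem_ofPred_eq] at hv
    rw [dif_pos hv, incl_mk, ψ.right_inv hv]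
  open_source := ψ.open_source.preimage isEmbedding_incl.continuous
  open_target := ψ.open_target.preimage (by fun_prop)
  continuousOn_toFun := continuous_fst.comp_continuousOn
    (ψ.continuousOn.comp isEmbedding_incl.continuous.continuousOn fun _ hq => hq)
  continuousOn_invFun := by
    rw [isEmbedding_incl.isInducing.continuousOn_iff]
    have h1 : ContinuousOn (fun v => ψ.symm (v, (ψ (incl hS p)).2))
        {v | (v, (ψ (incl hS p)).2) ∈ ψ.target} :=
      ψ.continuousOn_symm.comp (by fun_prop) fun v hv => hv
    refine h1.congr fun v hv => ?_
    rw [mem_ofPred_eq] at hv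
    simp only [Function.comp_apply, dif_pos hv, incl_mk]

lemma incl_chart_symm {p : Slice hS}
    {ψ : OpenPartialHomeomorph M (EuclideanSpace ℝ (Fin (n - 1)) × ℝ)}
    {hψ : ∀ y ∈ ψ.source, y ∈ S ↔ (ψ y).2 = (ψ (incl hS p)).2} {v : EuclideanSpace ℝ (Fin (n - 1))}
    (hv : v ∈ (chart p ψ hψ).target) :
    incl hS ((chart p ψ hψ).symm v) = ψ.symm (v, (ψ (incl hS p)).2) := by
  have hv' : (v, (ψ (incl hS p)).2) ∈ ψ.target := hv
  exact congrArg (incl hS) (dif_pos hv')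

/-- A foliated chart around a point of a slice set. -/
def foliatedChart (p : Slice hS) :
    OpenPartialHomeomorph M (EuclideanSpace ℝ (Fin (n - 1)) × ℝ) :=
  (hS (incl hS p) (incl_mem p)).choose

lemma isFoliatedChart (p : Slice hS) : η.IsFoliatedChart h (foliatedChart p) :=
  (hS (incl hS p) (incl_mem p)).choose_spec.1

lemma mem_foliatedChart_source (p : Slice hS) : incl hS p ∈ (foliatedChart p).source :=
  (hS (incl hS p) (incl_mem p)).choose_spec.2.1

lemma mem_iff_foliatedChart (p : Slice hS) : ∀ y ∈ (foliatedChart p).source,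
    y ∈ S ↔ (foliatedChart p y).2 = (foliatedChart p (incl hS p)).2 :=
  (hS (incl hS p) (incl_mem p)).choose_spec.2.2

instance : ChartedSpace (EuclideanSpace ℝ (Fin (n - 1))) (Slice hS) where
  atlas := range fun p => chart p (foliatedChart p) (mem_iff_foliatedChart p)
  chartAt p := chart p (foliatedChart p) (mem_iff_foliatedChart p)
  mem_chart_source p := mem_foliatedChart_source p
  chart_mem_atlas p := mem_range_self p

lemma chartAt_eq (p : Slice hS) : chartAt (EuclideanSpace ℝ (Fin (n - 1))) p =
    chart p (foliatedChart p) (mem_iff_foliatedChart p) := rfl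

instance : IsManifold (𝓡 (n - 1)) ∞ (Slice hS) := by
  refine isManifold_of_contDiffOn _ _ _ ?_
  rintro _ _ ⟨p, rfl⟩ ⟨q, rfl⟩
  rw [← contMDiffOn_iff_contDiffOn]
  rintro v ⟨⟨hv1, hv2⟩, -⟩
  have hv1' : (v, (foliatedChart p (incl hS p)).2) ∈ (foliatedChart p).target := hv1
  have hv2' : (foliatedChart p).symm (v, (foliatedChart p (incl hS p)).2) ∈
      (foliatedChart q).source := by
    have hv1t : v ∈ (chart p (foliatedChart p) (mem_iff_foliatedChart p)).target := hv1
    rw [← incl_chart_symm hv1t]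
    exact hv2
  have h1 : ContMDiffAt (𝓡 (n - 1)) (𝓡 (n - 1)) ∞ (fun w => (foliatedChart q
      ((foliatedChart p).symm (w, (foliatedChart p (incl hS p)).2))).1) v := by
    have h2 : ContMDiffAt (𝓡 (n - 1)) 𝓘(ℝ, EuclideanSpace ℝ (Fin (n - 1)) × ℝ) ∞
        (fun w => (w, (foliatedChart p (incl hS p)).2)) v :=
      (contDiff_id.prodMk contDiff_const).contMDiff.contMDiffAt
    have h3 := ((isFoliatedChart q).contMDiffAt hv2').comp v
      (((isFoliatedChart p).contMDiffAt_symm hv1').comp v h2)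
    exact contDiff_fst.contMDiff.contMDiffAt.comp v h3
  refine ContMDiffAt.contMDiffWithinAt (h1.congr_of_eventuallyEq ?_)
  filter_upwards [(chart p (foliatedChart p) (mem_iff_foliatedChart p)).open_target.mem_nhds hv1]
    with w hw
  change (foliatedChart q (incl hS ((chart p (foliatedChart p)
    (mem_iff_foliatedChart p)).symm w))).1 = _
  exact congrArg (fun z => (foliatedChart q z).1) (incl_chart_symm hw)

/-- The inclusion of a slice set is smooth. -/
lemma contMDiff_incl : ContMDiff (𝓡 (n - 1)) (𝓡 n) ∞ (incl hS) := by
  intro p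
  have hp := (isFoliatedChart p).contMDiffAt_symm
    ((foliatedChart p).map_source (mem_foliatedChart_source p))
  have h1 : ContMDiffAt (𝓡 (n - 1)) (𝓡 (n - 1)) ∞
      (chartAt (EuclideanSpace ℝ (Fin (n - 1))) p) p :=
    contMDiffOn_chart.contMDiffAt (chart_source_mem_nhds _ p)
  have h2 : ContMDiffAt (𝓡 (n - 1)) 𝓘(ℝ, EuclideanSpace ℝ (Fin (n - 1)) × ℝ) ∞
      (fun w : EuclideanSpace ℝ (Fin (n - 1)) => (w, (foliatedChart p (incl hS p)).2))
        (chartAt (EuclideanSpace ℝ (Fin (n - 1))) p p) :=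
    (contDiff_id.prodMk contDiff_const).contMDiff.contMDiffAt
  refine (ContMDiffAt.comp p hp (h2.comp p h1)).congr_of_eventuallyEq ?_
  filter_upwards [chart_source_mem_nhds (EuclideanSpace ℝ (Fin (n - 1))) p] with q hq
  have h3 := (chartAt (EuclideanSpace ℝ (Fin (n - 1))) p).map_source hq
  rw [chartAt_eq] at h3
  have h4 := incl_chart_symm h3
  rw [← chartAt_eq, (chartAt (EuclideanSpace ℝ (Fin (n - 1))) p).left_inv hq] at h4
  exact h4

/-- A map into a slice set is smooth if its composition with the inclusion is smooth. -/
lemma contMDiffWithinAt_of_incl {E' H' N : Type*} [NormedAddCommGroup E'] [NormedSpace ℝ E']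
    [TopologicalSpace H'] {I' : ModelWithCorners ℝ E' H'} [TopologicalSpace N] [ChartedSpace H' N]
    {g : N → Slice hS} {s : Set N} {a : N}
    (hg : ContMDiffWithinAt I' (𝓡 n) ∞ (incl hS ∘ g) s a) :
    ContMDiffWithinAt I' (𝓡 (n - 1)) ∞ g s a := by
  have hc : ContinuousWithinAt g s a :=
    isEmbedding_incl.isInducing.continuousWithinAt_iff.2 hg.continuousWithinAt
  rw [contMDiffWithinAt_iff_target]
  refine ⟨hc, ?_⟩
  have h1 := ((isFoliatedChart (g a)).contMDiffAt (mem_foliatedChart_source (g a))).comp_contMDiffWithinAt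
    (f := incl hS ∘ g) a hg
  have h2 := contDiff_fst.contMDiff.contMDiffAt.comp_contMDiffWithinAt a h1
  exact h2

variable (hS) in
lemma mdifferentiableAt_incl (p : Slice hS) : MDifferentiableAt (𝓡 (n - 1)) (𝓡 n) (incl hS) p :=
  (contMDiff_incl p).mdifferentiableAt (by simp)

/-- In a foliated chart, the differential of the inclusion of a slice set `S` is an isomorphism onto
`ℝⁿ⁻¹ × 0`. -/
lemma hasMFDerivAt_foliatedChart_comp_incl (p : Slice hS) :
    ∃ T : TangentSpace (𝓡 (n - 1)) p →L[ℝ] EuclideanSpace ℝ (Fin (n - 1)), Function.Bijective T ∧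
      ∀ v, mfderiv (𝓡 n) 𝓘(ℝ, EuclideanSpace ℝ (Fin (n - 1)) × ℝ) (foliatedChart p) (incl hS p)
        (mfderiv (𝓡 (n - 1)) (𝓡 n) (incl hS) p v) = (T v, (0 : ℝ)) := by
  have hφ : (chartAt (EuclideanSpace ℝ (Fin (n - 1))) p).MDifferentiable (𝓡 (n - 1)) (𝓡 (n - 1)) :=
    mdifferentiable_chart p
  refine ⟨mfderiv (𝓡 (n - 1)) (𝓡 (n - 1)) (chartAt (EuclideanSpace ℝ (Fin (n - 1))) p) p,
    hφ.mfderiv_bijective (mem_chart_source _ p), fun v => ?_⟩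
  have h1 := mfderiv_comp p (((isFoliatedChart p).contMDiffAt
    (mem_foliatedChart_source p)).mdifferentiableAt (by simp)) (mdifferentiableAt_incl hS p)
  have h2 : (foliatedChart p ∘ incl hS) =ᶠ[𝓝 p]
      fun q => (chartAt (EuclideanSpace ℝ (Fin (n - 1))) p q, (foliatedChart p (incl hS p)).2) := by
    filter_upwards [chart_source_mem_nhds (EuclideanSpace ℝ (Fin (n - 1))) p] with q hq
    exact Prod.ext rfl ((mem_iff_foliatedChart p _ hq).1 (incl_mem q))
  have h3 : HasMFDerivAt (𝓡 (n - 1)) 𝓘(ℝ, EuclideanSpace ℝ (Fin (n - 1)) × ℝ)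
      (fun q => (chartAt (EuclideanSpace ℝ (Fin (n - 1))) p q, (foliatedChart p (incl hS p)).2)) p _ :=
    ((hasFDerivAt_id (𝕜 := ℝ) (chartAt (EuclideanSpace ℝ (Fin (n - 1))) p p)).prodMk
      (hasFDerivAt_const (𝕜 := ℝ) (foliatedChart p (incl hS p)).2 _)).hasMFDerivAt.comp p
      (hφ.mdifferentiableAt (mem_chart_source _ p)).hasMFDerivAt
  rw [h2.mfderiv_eq, h3.mfderiv] at h1
  exact (DFunLike.congr_fun h1 v).symm

/-- A slice set is an integral manifold of `ker η`. -/
theorem isIntegralManifold {M : Type u} [TopologicalSpace M]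
    [ChartedSpace (EuclideanSpace ℝ (Fin n)) M] [IsManifold (𝓡 n) ∞ M]
    {η : OneForm n M} {h : M → Circle} {S : Set M} (hS : η.IsSlice h S) :
    η.IsIntegralManifold (Slice hS) (incl hS) where
  contMDiff := contMDiff_incl
  injective := isEmbedding_incl.injective
  immersion p := by
    obtain ⟨T, hT, hTv⟩ := hasMFDerivAt_foliatedChart_comp_incl p
    intro v w hvw
    have h1 := hTv v
    rw [hvw, hTv w] at h1
    exact (hT.1 (Prod.ext_iff.1 h1).1).symm
  tangent p := by
    obtain ⟨T, hT, hTv⟩ := hasMFDerivAt_foliatedChart_comp_incl p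
    ext v
    rw [mem_ofPred_eq, (isFoliatedChart p).ker _ (mem_foliatedChart_source p)]
    constructor
    · rintro ⟨w, rfl⟩
      rw [hTv w]
    · intro hv
      obtain ⟨w, hw⟩ := hT.2 (mfderiv (𝓡 n) 𝓘(ℝ, EuclideanSpace ℝ (Fin (n - 1)) × ℝ)
        (foliatedChart p) (incl hS p) v).1
      refine ⟨w, (isFoliatedChart p).mfderiv_injective (mem_foliatedChart_source p) ?_⟩
      rw [hTv w, hw]
      exact Prod.ext rfl hv.symm

end Slice

variable {M : Type*} [TopologicalSpace M] [ChartedSpace (EuclideanSpace ℝ (Fin n)) M]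
  [IsManifold (𝓡 n) ∞ M] {η : OneForm n M} {h : M → Circle}

/-- The fibres of a phase are slice sets. -/
lemma OneForm.IsPhase.isSlice_fiber (hh : η.IsPhase h) (hvanish : η.IsNowhereVanishing)
    (z : Circle) : η.IsSlice h (h ⁻¹' {z}) := by
  intro x hx
  obtain ⟨ψ, hψ, hxψ⟩ := hh.exists_isFoliatedChart hvanish x
  refine ⟨ψ, hψ, hxψ, fun y hy => ?_⟩
  rw [← hψ.eq_iff_snd_eq hy hxψ, mem_preimage, mem_singleton_iff, hx]

/-- The connected components of the fibres of a phase are slice sets, since plaques are connected. -/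
lemma OneForm.IsPhase.isSlice_connectedComponentIn (hh : η.IsPhase h)
    (hvanish : η.IsNowhereVanishing) (z : Circle) (x : M) :
    η.IsSlice h (connectedComponentIn (h ⁻¹' {z}) x) := by
  intro y hy
  obtain ⟨ψ, hψ, hyψ⟩ := hh.exists_isFoliatedChart hvanish y
  have hyz : h y = z := connectedComponentIn_subset (h ⁻¹' {z}) x hy
  refine ⟨ψ, hψ, hyψ, fun w hw => ⟨fun hwC => ?_, fun hwy => ?_⟩⟩
  · have hwz : h w = z := connectedComponentIn_subset (h ⁻¹' {z}) x hwC
    exact hψ.snd_eq_of_eq hw hyψ (hwz.trans hyz.symm)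
  · rw [connectedComponentIn_eq hy]
    refine (hψ.isPreconnected_plaque (ψ y).2).subset_connectedComponentIn ⟨hyψ, rfl⟩ ?_ ⟨hw, hwy⟩
    rintro v ⟨hv, hvy⟩
    exact ((hψ.eq_iff_snd_eq hv hyψ).2 hvy).trans hyz

end Slice

/-! ### Leaves as components of fibres -/

section Leaves

open Filter Topology

/-- A real function whose differential vanishes near `p` is constant near `p`. -/
lemma eventually_eq_of_mfderiv_eq_zero {m : ℕ} {N : Type*} [TopologicalSpace N]
    [ChartedSpace (EuclideanSpace ℝ (Fin m)) N] [IsManifold (𝓡 m) ∞ N] {f : N → ℝ} {p : N}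
    (hf : ∀ᶠ q in 𝓝 p, HasMFDerivAt (𝓡 m) 𝓘(ℝ, ℝ) f q 0) : ∀ᶠ q in 𝓝 p, f q = f p := by
  set φ := chartAt (EuclideanSpace ℝ (Fin m)) p with hφ
  have hpφ : p ∈ φ.source := mem_chart_source _ p
  have h1 : ∀ᶠ y in 𝓝 (φ p), y ∈ φ.target ∧ HasMFDerivAt (𝓡 m) 𝓘(ℝ, ℝ) f (φ.symm y) 0 := by
    have h0 := φ.continuousAt_symm (φ.map_source hpφ)
    rw [ContinuousAt, φ.left_inv hpφ] at h0
    filter_upwards [φ.open_target.mem_nhds (φ.map_source hpφ), h0.eventually hf] with y hy hy'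
      using ⟨hy, hy'⟩
  obtain ⟨r, hr, hball⟩ := Metric.eventually_nhds_iff_ball.1 h1
  have h2 : ∀ y ∈ Metric.ball (φ p) r, HasFDerivAt (f ∘ φ.symm) (0 : _ →L[ℝ] ℝ) y := by
    intro y hy
    obtain ⟨hyt, hy0⟩ := hball y hy
    have h3 : HasMFDerivAt (𝓡 m) 𝓘(ℝ, ℝ) (f ∘ φ.symm) y _ := hy0.comp y
      ((contMDiffOn_chart_symm (n := ∞).contMDiffAt
        (φ.open_target.mem_nhds hyt)).mdifferentiableAt (by simp)).hasMFDerivAt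
    have h4 := h3.hasFDerivAt
    rwa [ContinuousLinearMap.zero_comp] at h4
  have h5 : ∀ y ∈ Metric.ball (φ p) r, f (φ.symm y) = f p := by
    intro y hy
    have := (convex_ball (φ p) r).is_const_of_fderivWithin_eq_zero (𝕜 := ℝ) (f := f ∘ φ.symm)
      (fun y hy => (h2 y hy).differentiableAt.differentiableWithinAt)
      (fun y hy => by
        rw [fderivWithin_of_isOpen Metric.isOpen_ball hy, (h2 y hy).fderiv]) hy
      (Metric.mem_ball_self hr)
    simpa [φ.left_inv hpφ] using this
  filter_upwards [φ.open_source.mem_nhds hpφ,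
    (φ.continuousAt hpφ).preimage_mem_nhds (Metric.ball_mem_nhds _ hr)] with q hq hqr
  rw [← h5 _ hqr, φ.left_inv hq]

variable {n : ℕ} {M : Type u} [TopologicalSpace M]
  [ChartedSpace (EuclideanSpace ℝ (Fin n)) M] [IsManifold (𝓡 n) ∞ M]
  {η : OneForm n M} {h : M → Circle}

section IntegralManifold

variable {N : Type u} [TopologicalSpace N] [ChartedSpace (EuclideanSpace ℝ (Fin (n - 1))) N]
  [IsManifold (𝓡 (n - 1)) ∞ N] {ι : N → M}

lemma OneForm.IsIntegralManifold.hasMFDerivAt_snd (hι : η.IsIntegralManifold N ι)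
    {ψ : OpenPartialHomeomorph M (EuclideanSpace ℝ (Fin (n - 1)) × ℝ)}
    (hψ : η.IsFoliatedChart h ψ) {p : N} (hp : ι p ∈ ψ.source) :
    HasMFDerivAt (𝓡 (n - 1)) 𝓘(ℝ, ℝ) (fun q => (ψ (ι q)).2) p 0 := by
  have h1 : HasMFDerivAt (𝓡 (n - 1)) 𝓘(ℝ, ℝ) (fun q => (ψ (ι q)).2) p _ :=
    (ContinuousLinearMap.hasMFDerivAt (ContinuousLinearMap.snd ℝ
        (EuclideanSpace ℝ (Fin (n - 1))) ℝ)).comp p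
      (((hψ.contMDiffAt hp).mdifferentiableAt (by simp)).hasMFDerivAt.comp p
      ((hι.contMDiff p).mdifferentiableAt (by simp)).hasMFDerivAt)
  refine h1.congr_mfderiv (ContinuousLinearMap.ext fun v => ?_)
  have h2 : mfderiv (𝓡 (n - 1)) (𝓡 n) ι p v ∈ {v | η.eval (ι p) v = 0} :=
    hι.tangent p ▸ mem_range_self v
  exact (hψ.ker _ hp _).1 h2

/-- A phase is locally constant on an integral manifold. -/
lemma OneForm.IsIntegralManifold.isLocallyConstant (hι : η.IsIntegralManifold N ι)
    (hh : η.IsPhase h) (hvanish : η.IsNowhereVanishing) : IsLocallyConstant (h ∘ ι) := by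
  rw [IsLocallyConstant.iff_eventually_eq]
  intro p
  obtain ⟨ψ, hψ, hp⟩ := hh.exists_isFoliatedChart hvanish (ι p)
  have h1 : ∀ᶠ q in 𝓝 p, ι q ∈ ψ.source :=
    (hι.contMDiff.continuous.continuousAt).preimage_mem_nhds (ψ.open_source.mem_nhds hp)
  filter_upwards [h1, eventually_eq_of_mfderiv_eq_zero
    (h1.mono fun q hq => hι.hasMFDerivAt_snd hψ hq)] with q hq hqp
  exact (hψ.eq_iff_snd_eq hq hp).2 hqp

/-- A connected integral manifold lies in a connected component of a fibre of a phase. -/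
lemma OneForm.IsIntegralManifold.range_subset [ConnectedSpace N] (hι : η.IsIntegralManifold N ι)
    (hh : η.IsPhase h) (hvanish : η.IsNowhereVanishing) (p : N) :
    range ι ⊆ connectedComponentIn (h ⁻¹' {h (ι p)}) (ι p) := by
  refine (isPreconnected_range hι.contMDiff.continuous).subset_connectedComponentIn
    (mem_range_self p) ?_
  rintro _ ⟨q, rfl⟩
  exact (hι.isLocallyConstant hh hvanish).apply_eq_of_isPreconnected isPreconnected_univ
    (mem_univ q) (mem_univ p)

/-- An integral manifold is locally the whole plaque through each of its points: the first
coordinate of a foliated chart restricts to a map between manifolds of equal dimension with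
injective differential, hence to an open map. -/
lemma OneForm.IsIntegralManifold.image_mem_nhdsWithin (hι : η.IsIntegralManifold N ι)
    (hh : η.IsPhase h) (hvanish : η.IsNowhereVanishing) {p : N} {O : Set N} (hO : O ∈ 𝓝 p) :
    ι '' O ∈ 𝓝[h ⁻¹' {h (ι p)}] (ι p) := by
  obtain ⟨ψ, hψ, hp⟩ := hh.exists_isFoliatedChart hvanish (ι p)
  set φ := chartAt (EuclideanSpace ℝ (Fin (n - 1))) p with hφ
  have hpφ : p ∈ φ.source := mem_chart_source _ p
  have h1 : ∀ᶠ q in 𝓝 p, ι q ∈ ψ.source :=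
    (hι.contMDiff.continuous.continuousAt).preimage_mem_nhds (ψ.open_source.mem_nhds hp)
  have h2 : ∀ᶠ q in 𝓝 p, (ψ (ι q)).2 = (ψ (ι p)).2 := eventually_eq_of_mfderiv_eq_zero
    (h1.mono fun q hq => hι.hasMFDerivAt_snd hψ hq)
  let g : EuclideanSpace ℝ (Fin (n - 1)) → EuclideanSpace ℝ (Fin (n - 1)) :=
    fun y => (ψ (ι (φ.symm y))).1
  have hφs : ContMDiffAt (𝓡 (n - 1)) (𝓡 (n - 1)) ∞ φ.symm (φ p) :=
    contMDiffOn_chart_symm.contMDiffAt (φ.open_target.mem_nhds (φ.map_source hpφ))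
  have hψι : ContMDiffAt (𝓡 (n - 1)) 𝓘(ℝ, EuclideanSpace ℝ (Fin (n - 1)) × ℝ) ∞
      (ψ ∘ ι ∘ φ.symm) (φ p) := by
    refine ContMDiffAt.comp _ ?_ (ContMDiffAt.comp _ (hι.contMDiff _) hφs)
    simpa [φ.left_inv hpφ] using hψ.contMDiffAt hp
  have hgc : ContDiffAt ℝ ∞ g (φ p) :=
    (contDiff_fst.contMDiff.contMDiffAt.comp (φ p) hψι).contDiffAt
  have hginj : Function.Injective (fderiv ℝ g (φ p)) := by
    have hp' : ι (φ.symm (φ p)) ∈ ψ.source := by rwa [φ.left_inv hpφ]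
    have h3 : HasMFDerivAt (𝓡 (n - 1)) 𝓘(ℝ, EuclideanSpace ℝ (Fin (n - 1)) × ℝ)
        (ψ ∘ ι ∘ φ.symm) (φ p) _ :=
      ((hψ.contMDiffAt hp').mdifferentiableAt (by simp)).hasMFDerivAt.comp (φ p)
        (((hι.contMDiff _).mdifferentiableAt (by simp)).hasMFDerivAt.comp (φ p)
          (hφs.mdifferentiableAt (by simp)).hasMFDerivAt)
    have h4 := h3.hasFDerivAt.fst
    rw [HasFDerivAt.fderiv (f := g) h4]
    refine (injective_iff_map_eq_zero _).2 fun v hv => ?_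
    have h5 : mfderiv (𝓡 (n - 1)) (𝓡 n) ι (φ.symm (φ p))
        (mfderiv (𝓡 (n - 1)) (𝓡 (n - 1)) φ.symm (φ p) v) ∈
        {v | η.eval (ι (φ.symm (φ p))) v = 0} :=
      hι.tangent _ ▸ mem_range_self _
    have h6 := hψ.mfderiv_injective hp' (a₁ := mfderiv (𝓡 (n - 1)) (𝓡 n) ι (φ.symm (φ p))
        (mfderiv (𝓡 (n - 1)) (𝓡 (n - 1)) φ.symm (φ p) v)) (a₂ := 0) (by
      rw [map_zero]
      exact Prod.ext hv ((hψ.ker _ hp' _).1 h5))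
    have h7 := hι.immersion _ (h6.trans (map_zero _).symm)
    exact ((mdifferentiable_chart (I := 𝓡 (n - 1)) p).symm.mfderiv_bijective
      (φ.map_source hpφ)).1 (h7.trans (map_zero _).symm)
  obtain ⟨g', hg'⟩ : ∃ g' : EuclideanSpace ℝ (Fin (n - 1)) ≃L[ℝ] EuclideanSpace ℝ (Fin (n - 1)),
      (g' : EuclideanSpace ℝ (Fin (n - 1)) →L[ℝ] _) = fderiv ℝ g (φ p) :=
    ⟨(LinearEquiv.ofInjectiveEndo _ hginj).toContinuousLinearEquiv, by ext; rfl⟩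
  have hmap : map g (𝓝 (φ p)) = 𝓝 (g (φ p)) := by
    refine HasStrictFDerivAt.map_nhds_eq_of_equiv (f' := g') ?_
    rw [hg']
    exact hgc.hasStrictFDerivAt (by simp)
  have hO' : φ '' (φ.source ∩ (O ∩ {q | ι q ∈ ψ.source ∧ (ψ (ι q)).2 = (ψ (ι p)).2})) ∈ 𝓝 (φ p) := by
    rw [← φ.map_nhds_eq hpφ]
    exact image_mem_map (inter_mem (φ.open_source.mem_nhds hpφ) (inter_mem hO (h1.and h2)))
  have hgO := hmap ▸ image_mem_map hO'
  have hgp : g (φ p) = (ψ (ι p)).1 := by simp [g, φ.left_inv hpφ]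
  rw [hgp] at hgO
  have h3 : ∀ᶠ x in 𝓝 (ι p), (ψ x).1 ∈ g '' (φ '' (φ.source ∩
      (O ∩ {q | ι q ∈ ψ.source ∧ (ψ (ι q)).2 = (ψ (ι p)).2}))) :=
    (continuous_fst.continuousAt.comp (ψ.continuousAt hp)).preimage_mem_nhds hgO
  rw [mem_nhdsWithin_iff_eventually]
  filter_upwards [h3, ψ.open_source.mem_nhds hp] with x hx hxs hxh
  obtain ⟨_, ⟨q, ⟨hq1, hq2, hq3, hq4⟩, rfl⟩, hq5⟩ := hx
  refine ⟨q, hq2, ψ.injOn hq3 hxs (Prod.ext ?_ ?_)⟩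
  · simpa [g, φ.left_inv hq1] using hq5
  · rw [hq4]
    exact (hψ.snd_eq_of_eq hxs hp hxh).symm

end IntegralManifold

instance Slice.t2Space [T2Space M] {S : Set M} (hS : η.IsSlice h S) : T2Space (Slice hS) :=
  inferInstanceAs (T2Space S)

lemma Slice.secondCountableTopology [SecondCountableTopology M] {S : Set M}
    (hS : η.IsSlice h S) : SecondCountableTopology (Slice hS) :=
  inferInstanceAs (SecondCountableTopology S)

lemma Slice.connectedSpace {S : Set M} (hS : η.IsSlice h S) (hc : IsConnected S) :
    ConnectedSpace (Slice hS) :=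
  isConnected_iff_connectedSpace.1 hc

variable [T2Space M] [CompactSpace M]

/-- A connected component of a fibre of a phase is a leaf. -/
lemma OneForm.IsPhase.isLeaf_incl (hh : η.IsPhase h) (hvanish : η.IsNowhereVanishing) (x : M) :
    haveI := ChartedSpace.secondCountable_of_sigmaCompact (EuclideanSpace ℝ (Fin n)) M
    haveI := Slice.secondCountableTopology (hh.isSlice_connectedComponentIn hvanish (h x) x)
    haveI := Slice.connectedSpace (hh.isSlice_connectedComponentIn hvanish (h x) x)
      (isConnected_connectedComponentIn_iff.2 rfl)
    η.IsLeaf (Slice (hh.isSlice_connectedComponentIn hvanish (h x) x))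
      (Slice.incl (hh.isSlice_connectedComponentIn hvanish (h x) x)) := by
  have hC := hh.isSlice_connectedComponentIn hvanish (h x) x
  have := ChartedSpace.secondCountable_of_sigmaCompact (EuclideanSpace ℝ (Fin n)) M
  have := Slice.secondCountableTopology hC
  have := Slice.connectedSpace hC (isConnected_connectedComponentIn_iff.2 rfl)
  refine ⟨Slice.isIntegralManifold hC, ?_⟩
  intro N' _ _ _ _ _ _ ι' hι' hsub
  rw [Slice.range_incl] at hsub ⊢
  obtain ⟨p, hp⟩ := hsub (mem_connectedComponentIn rfl)
  have := hι'.range_subset hh hvanish p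
  rw [hp] at this
  exact this.antisymm hsub

/-- The image of a leaf is the connected component of a fibre of any phase. -/
lemma OneForm.IsLeaf.range_eq {N : Type u} [TopologicalSpace N] [T2Space N]
    [SecondCountableTopology N] [ConnectedSpace N]
    [ChartedSpace (EuclideanSpace ℝ (Fin (n - 1))) N] [IsManifold (𝓡 (n - 1)) ∞ N]
    {ι : N → M} (hι : η.IsLeaf N ι) (hh : η.IsPhase h) (hvanish : η.IsNowhereVanishing) (p : N) :
    range ι = connectedComponentIn (h ⁻¹' {h (ι p)}) (ι p) := by
  have hC := hh.isSlice_connectedComponentIn hvanish (h (ι p)) (ι p)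
  have := ChartedSpace.secondCountable_of_sigmaCompact (EuclideanSpace ℝ (Fin n)) M
  have := Slice.secondCountableTopology hC
  have := Slice.connectedSpace hC (isConnected_connectedComponentIn_iff.2 rfl)
  have := hι.maximal (Slice hC) (Slice.incl hC) (Slice.isIntegralManifold hC)
    (by
      rw [Slice.range_incl]
      exact hι.isIntegralManifold.range_subset hh hvanish p)
  rw [← this, Slice.range_incl]

/-- The leaves are the connected components of the fibres of a phase. -/
theorem OneForm.IsPhase.isLeafSet_iff (hh : η.IsPhase h) (hvanish : η.IsNowhereVanishing)
    (S : Set M) : η.IsLeafSet S ↔ ∃ x : M, S = connectedComponentIn (h ⁻¹' {h x}) x := by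
  constructor
  · rintro ⟨N, _, _, _, _, _, _, ι, hι, rfl⟩
    obtain ⟨p⟩ : Nonempty N := inferInstance
    exact ⟨ι p, hι.range_eq hh hvanish p⟩
  · rintro ⟨x, rfl⟩
    exact ⟨_, _, _, _, _, _, _, _, hh.isLeaf_incl hvanish x, Slice.range_incl _⟩

/-- The leaf topology of a leaf is the subspace topology of a connected component of a fibre of a
phase, so it is compact. -/
theorem OneForm.IsLeaf.compactSpace {N : Type u} [TopologicalSpace N] [T2Space N]
    [SecondCountableTopology N] [ConnectedSpace N]
    [ChartedSpace (EuclideanSpace ℝ (Fin (n - 1))) N] [IsManifold (𝓡 (n - 1)) ∞ N]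
    {ι : N → M} (hι : η.IsLeaf N ι) (hh : η.IsPhase h) (hhc : Continuous h)
    (hvanish : η.IsNowhereVanishing) : CompactSpace N := by
  obtain ⟨p⟩ : Nonempty N := inferInstance
  have hcl : _root_.IsClosed (range ι) := by
    rw [hι.range_eq hh hvanish p]
    refine isClosed_of_closure_subset
      (isPreconnected_connectedComponentIn.closure.subset_connectedComponentIn
        (subset_closure (mem_connectedComponentIn rfl)) ?_)
    exact closure_minimal (connectedComponentIn_subset _ _) (isClosed_singleton.preimage hhc)
  have hind : IsInducing ι := by
    rw [isInducing_iff_nhds]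
    refine fun q => le_antisymm
      (hι.isIntegralManifold.contMDiff.continuous.continuousAt).le_comap fun O hO => ?_
    obtain ⟨U, hU, hUO⟩ := mem_nhdsWithin_iff_exists_mem_nhds_inter.1
      (hι.isIntegralManifold.image_mem_nhdsWithin hh hvanish hO)
    refine ⟨U, hU, fun q' hq' => ?_⟩
    obtain ⟨q'', hq'', heq⟩ := hUO ⟨hq', (hι.isIntegralManifold.isLocallyConstant hh
      hvanish).apply_eq_of_isPreconnected isPreconnected_univ (mem_univ q') (mem_univ q)⟩
    rwa [← hι.isIntegralManifold.injective heq]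
  exact (hind.isCompact_iff.2 (by rw [image_univ]; exact hcl.isCompact)) |> isCompact_univ_iff.1

end Leaves

/-! ### Angles on the circle -/

section CircleAngle

open Filter Topology

/-- The angle from `z` to `w` on the unit circle, in `(-π, π]`. -/
def Circle.angle (z w : Circle) : ℝ := Complex.arg ((w / z : Circle) : ℂ)

lemma Circle.exp_angle (z w : Circle) : Circle.exp (Circle.angle z w) = w / z :=
  Circle.exp_arg _

lemma Circle.angle_self (z : Circle) : Circle.angle z z = 0 := by
  simp [Circle.angle]

lemma Circle.angle_exp_exp {s t : ℝ} (h : |t - s| < Real.pi) :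
    Circle.angle (Circle.exp s) (Circle.exp t) = t - s := by
  rw [Circle.angle, ← Circle.exp_sub]
  exact Circle.arg_exp (abs_lt.1 h).1 (abs_lt.1 h).2.le

lemma Circle.contMDiffAt_angle {s t : ℝ} (h : |t - s| < Real.pi) :
    ContMDiffAt (𝓡 1) 𝓘(ℝ, ℝ) ∞ (Circle.angle (Circle.exp s)) (Circle.exp t) := by
  have h1 : ContMDiffAt (𝓡 1) (𝓡 1) ∞ (fun w : Circle => w * (Circle.exp s)⁻¹) (Circle.exp t) :=
    contMDiffAt_id.mul contMDiffAt_const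
  have h2 : ContMDiff (𝓡 1) 𝓘(ℝ, ℂ) ∞ (fun w : Circle => (w : ℂ)) :=
    haveI : Fact (Module.finrank ℝ ℂ = 1 + 1) := ⟨Complex.finrank_real_complex⟩
    contMDiff_coe_sphere
  have h3 : ((Circle.exp t / Circle.exp s : Circle) : ℂ) ∈ Complex.slitPlane := by
    rw [Complex.mem_slitPlane_iff_arg]
    refine ⟨?_, Circle.coe_ne_zero _⟩
    have := Circle.angle_exp_exp h
    rw [Circle.angle] at this
    rw [this]
    exact (abs_lt.1 h).2.ne
  have h4 : ContDiffAt ℝ ∞ Complex.arg ((Circle.exp t / Circle.exp s : Circle) : ℂ) := by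
    have h5 : ContDiffAt ℝ ∞ Complex.log ((Circle.exp t / Circle.exp s : Circle) : ℂ) :=
      (Complex.contDiffAt_log h3).restrict_scalars ℝ
    have h6 : ContDiffAt ℝ ∞ (fun z => (Complex.log z).im) _ :=
      Complex.imCLM.contDiff.contDiffAt.comp _ h5
    simpa [Complex.log_im] using h6
  have h7 := (h2 (Circle.exp t * (Circle.exp s)⁻¹)).comp (Circle.exp t) h1
  rw [div_eq_mul_inv] at h4
  exact ContMDiffAt.comp (Circle.exp t) h4.contMDiffAt h7

/-- A local inverse of `t ↦ exp (i t)` with values near `s`. -/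
lemma Circle.exists_openPartialHomeomorph_angle (s : ℝ) :
    ∃ α : OpenPartialHomeomorph Circle ℝ, Circle.exp s ∈ α.source ∧
      (∀ t, α.symm t = Circle.exp t) ∧ (∀ w ∈ α.source, α w = s + Circle.angle (Circle.exp s) w) ∧
      ContMDiffOn (𝓡 1) 𝓘(ℝ, ℝ) ∞ α α.source := by
  obtain ⟨e, hs, he⟩ := isLocalHomeomorph_circleExp s
  let e' := e.restrOpen (Ioo (s - Real.pi) (s + Real.pi)) isOpen_Ioo
  have hmem : s ∈ e'.source := ⟨hs, by constructor <;> linarith [Real.pi_pos]⟩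
  have he' : ∀ t, e' t = Circle.exp t := fun t => by rw [he]; rfl
  have h1 : ∀ w ∈ e'.target, |e'.symm w - s| < Real.pi ∧ Circle.exp (e'.symm w) = w := by
    intro w hw
    have h2 := (e'.map_target hw).2
    refine ⟨abs_lt.2 ⟨by linarith [h2.1], by linarith [h2.2]⟩, ?_⟩
    rw [← he', e'.right_inv hw]
  have h3 : ∀ w ∈ e'.target, e'.symm w = s + Circle.angle (Circle.exp s) w := by
    intro w hw
    obtain ⟨h4, h5⟩ := h1 w hw
    have := Circle.angle_exp_exp h4
    rw [h5] at this
    rw [this]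
    ring
  refine ⟨e'.symm, ?_, he', h3, ?_⟩
  · rw [← he']
    exact e'.map_source hmem
  · intro w hw
    obtain ⟨h4, h5⟩ := h1 w hw
    have h6 := Circle.contMDiffAt_angle h4
    rw [h5] at h6
    exact (contMDiffAt_const.add h6).contMDiffWithinAt.congr h3 (h3 w hw)

end CircleAngle

/-! ### Retraction onto a fibre -/

section Retraction

open Filter Topology

variable {n : ℕ} {M : Type*} [TopologicalSpace M]
  [ChartedSpace (EuclideanSpace ℝ (Fin n)) M] [IsManifold (𝓡 n) ∞ M]
  {η : OneForm n M} {h : M → Circle}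

lemma OneForm.IsPhase.contMDiff (hh : η.IsPhase h) : ContMDiff (𝓡 n) (𝓡 1) ∞ h := by
  intro x
  obtain ⟨f, hf⟩ := hh x
  exact (contMDiff_circleExp.contMDiffAt.comp x hf.self_of_nhds.1).congr_of_eventuallyEq
    (hf.mono fun y hy => hy.2.1)

/-- A phase is an open map. -/
lemma OneForm.IsPhase.isOpenMap (hh : η.IsPhase h) (hvanish : η.IsNowhereVanishing) :
    IsOpenMap h := by
  rw [isOpenMap_iff_nhds_le]
  intro x
  obtain ⟨ψ, hψ, hx⟩ := hh.exists_isFoliatedChart hvanish x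
  have h1 : h =ᶠ[𝓝 x] fun y => Circle.exp (ψ y).2 := by
    filter_upwards [ψ.open_source.mem_nhds hx] with y hy using hψ.eq_exp y hy
  have h2 : map h (𝓝 x) = map Circle.exp (map Prod.snd (map ψ (𝓝 x))) := by
    rw [map_congr h1, map_map, map_map]
    rfl
  rw [h2, ψ.map_nhds_eq hx, isOpenMap_snd.map_nhds_eq continuous_snd.continuousAt,
    isLocalHomeomorph_circleExp.isOpenMap.map_nhds_eq Circle.exp.continuous.continuousAt,
    hψ.eq_exp x hx]

/-- A phase on a nonempty compact manifold is onto. -/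
lemma OneForm.IsPhase.surjective [CompactSpace M] [Nonempty M] (hh : η.IsPhase h)
    (hvanish : η.IsNowhereVanishing) : Function.Surjective h := by
  have h1 : IsClopen (range h) := ⟨(isCompact_range hh.contMDiff.continuous).isClosed,
    (hh.isOpenMap hvanish).isOpen_range⟩
  exact range_eq_univ.1 (h1.eq_univ (range_nonempty h))

lemma OneForm.IsPhase.eventually_contMDiffAt_angle (hh : η.IsPhase h)
    (hvanish : η.IsNowhereVanishing) (x : M) :
    ∀ᶠ y in 𝓝 x, ContMDiffAt (𝓡 n) 𝓘(ℝ, ℝ) ∞ (fun m => Circle.angle (h x) (h m)) y := by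
  obtain ⟨ψ, hψ, hx⟩ := hh.exists_isFoliatedChart hvanish x
  filter_upwards [ψ.open_source.mem_nhds hx] with y hy
  have h1 := Circle.contMDiffAt_angle (hψ.abs_snd_sub_snd_lt hx hy)
  rw [← hψ.eq_exp x hx, ← hψ.eq_exp y hy] at h1
  exact h1.comp y (hh.contMDiff y)

/-- One step in the construction of a retraction onto a fibre: within a foliated chart, move by
`-s χ` in the transverse direction. -/
lemma OneForm.IsPhase.exists_transverse_shift (hh : η.IsPhase h)
    (hvanish : η.IsNowhereVanishing) {z : Circle}
    {ψ : OpenPartialHomeomorph M (EuclideanSpace ℝ (Fin (n - 1)) × ℝ)}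
    (hψ : η.IsFoliatedChart h ψ) {χ : M → ℝ} (hχ : ContMDiff (𝓡 n) 𝓘(ℝ, ℝ) ∞ χ)
    (hsupp : tsupport χ ⊆ ψ.source) {ρ : M → M} {σ : M → ℝ} (hρ : ∀ x, h x = z → ρ x = x)
    (hρs : ∀ x, h x = z → ∀ᶠ m in 𝓝 x, ContMDiffAt (𝓡 n) (𝓡 n) ∞ ρ m ∧
      h (ρ m) = h m * Circle.exp (-(Circle.angle z (h m) * σ m))) :
    ∃ ρ' : M → M, (∀ x, h x = z → ρ' x = x) ∧
      ∀ x, h x = z → ∀ᶠ m in 𝓝 x, ContMDiffAt (𝓡 n) (𝓡 n) ∞ ρ' m ∧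
        h (ρ' m) = h m * Circle.exp (-(Circle.angle z (h m) * (χ m + σ m))) := by
  classical
  let s : M → ℝ := fun m => Circle.angle z (h m)
  let τ : M → EuclideanSpace ℝ (Fin (n - 1)) × ℝ := fun m => ψ (ρ m) - (0, s m * χ m)
  let ρ' : M → M := fun m => if ρ m ∈ ψ.source then ψ.symm (τ m) else ρ m
  have hs0 : ∀ x, h x = z → s x = 0 := by
    rintro x rfl
    exact Circle.angle_self _
  refine ⟨ρ', fun x hx => ?_, fun x hx => ?_⟩
  · simp only [ρ', τ, hρ x hx, hs0 x hx, zero_mul, Prod.mk_zero_zero, sub_zero]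
    split_ifs with h1
    · exact ψ.left_inv h1
    · rfl
  have hsm : ∀ᶠ m in 𝓝 x, ContMDiffAt (𝓡 n) 𝓘(ℝ, ℝ) ∞ s m := by
    subst hx
    exact hh.eventually_contMDiffAt_angle hvanish x
  by_cases hxχ : x ∈ tsupport χ
  · have hxψ : x ∈ ψ.source := hsupp hxχ
    have hρx : ContinuousAt ρ x := (hρs x hx).self_of_nhds.1.continuousAt
    have h1 : ∀ᶠ m in 𝓝 x, ρ m ∈ ψ.source :=
      hρx.preimage_mem_nhds (ψ.open_source.mem_nhds (by rwa [hρ x hx]))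
    have hτ : ∀ᶠ m in 𝓝 x, ContMDiffAt (𝓡 n) 𝓘(ℝ, EuclideanSpace ℝ (Fin (n - 1)) × ℝ) ∞ τ m := by
      filter_upwards [h1, hρs x hx, hsm] with m hm1 hm2 hm3
      refine ((hψ.contMDiffAt hm1).comp m hm2.1).sub ?_
      exact ContMDiffAt.prodMk_space contMDiffAt_const (hm3.mul (hχ m))
    have hτx : τ x = ψ x := by simp [τ, hρ x hx, hs0 x hx]
    have h2 : ∀ᶠ m in 𝓝 x, τ m ∈ ψ.target :=
      hτ.self_of_nhds.continuousAt.preimage_mem_nhds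
        (ψ.open_target.mem_nhds (by rw [hτx]; exact ψ.map_source hxψ))
    filter_upwards [h1.eventually_nhds, h2, hρs x hx, hτ] with m hm1 hm2 hm3 hm4
    have h3 : ρ' =ᶠ[𝓝 m] fun m => ψ.symm (τ m) := by
      filter_upwards [hm1] with m' hm' using if_pos hm'
    refine ⟨((hψ.contMDiffAt_symm hm2).comp m hm4).congr_of_eventuallyEq h3, ?_⟩
    rw [h3.eq_of_nhds, hψ.eq_exp _ (ψ.map_target hm2), ψ.right_inv hm2]
    have h4 : (τ m).2 = (ψ (ρ m)).2 + -(s m * χ m) := rfl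
    rw [h4, Circle.exp_add, ← hψ.eq_exp _ hm1.self_of_nhds, hm3.2, mul_assoc, ← Circle.exp_add]
    congr 2
    simp only [s]
    ring
  · have h1 : ∀ᶠ m in 𝓝 x, χ m = 0 := notMem_tsupport_iff_eventuallyEq.1 hxχ
    have h2 : ∀ᶠ m in 𝓝 x, ρ' m = ρ m := by
      filter_upwards [h1] with m hm
      simp only [ρ', τ, hm, mul_zero, Prod.mk_zero_zero, sub_zero]
      split_ifs with h3
      · exact ψ.left_inv h3
      · rfl
    filter_upwards [h1, h2.eventually_nhds, hρs x hx] with m hm1 hm2 hm3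
    refine ⟨hm3.1.congr_of_eventuallyEq hm2, ?_⟩
    rw [hm2.self_of_nhds, hm3.2, hm1, zero_add]

/-- **Retraction onto a fibre.** Near the fibre `h = z` there is a smooth map `ρ` into the fibre
which is the identity on the fibre. It is the composition of finitely many transverse shifts by
`-s χᵢ`, where `s` is the angle from `z` and `(χᵢ)` is a partition of unity subordinate to foliated
charts. -/
theorem OneForm.IsPhase.exists_retraction [T2Space M] [CompactSpace M] (hh : η.IsPhase h)
    (hvanish : η.IsNowhereVanishing) (z : Circle) :
    ∃ ρ : M → M, (∀ x, h x = z → ρ x = x) ∧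
      ∀ x, h x = z → ∀ᶠ m in 𝓝 x, ContMDiffAt (𝓡 n) (𝓡 n) ∞ ρ m ∧ h (ρ m) = z := by
  classical
  choose ψ hψ hxψ using hh.exists_isFoliatedChart hvanish
  obtain ⟨t, ht⟩ := CompactSpace.elim_nhds_subcover (fun x => (ψ x).source)
    fun x => (ψ x).open_source.mem_nhds (hxψ x)
  obtain ⟨χ, hχ⟩ := SmoothPartitionOfUnity.exists_isSubordinate (𝓡 n) (isClosed_univ (X := M))
    (fun i : t => (ψ i).source) (fun i => (ψ i).open_source) (by
      intro x _
      have hx : x ∈ ⋃ x ∈ t, (ψ x).source := ht ▸ mem_univ x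
      simpa using hx)
  have key : ∀ J : Finset t, ∃ ρ : M → M, (∀ x, h x = z → ρ x = x) ∧
      ∀ x, h x = z → ∀ᶠ m in 𝓝 x, ContMDiffAt (𝓡 n) (𝓡 n) ∞ ρ m ∧
        h (ρ m) = h m * Circle.exp (-(Circle.angle z (h m) * ∑ i ∈ J, χ i m)) := by
    intro J
    induction J using Finset.induction_on with
    | empty => exact ⟨id, fun _ _ => rfl, fun x _ => Eventually.of_forall fun m =>
        ⟨contMDiffAt_id, by simp⟩⟩
    | insert i J hi ih =>
      obtain ⟨ρ, h1, h2⟩ := ih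
      simp_rw [Finset.sum_insert hi]
      exact hh.exists_transverse_shift hvanish (hψ i) (χ i).contMDiff (hχ i) h1 h2
  obtain ⟨ρ, h1, h2⟩ := key Finset.univ
  refine ⟨ρ, h1, fun x hx => (h2 x hx).mono fun m hm => ⟨hm.1, ?_⟩⟩
  have h3 : ∑ i, χ i m = 1 := by
    rw [← finsum_eq_sum_of_fintype]
    exact χ.sum_eq_one (mem_univ m)
  rw [hm.2, h3, mul_one, Circle.exp_neg, Circle.exp_angle]
  simp

end Retraction

/-! ### The product structure along a fibre -/

section Trivialization

open Filter Topology

variable {n : ℕ} {M : Type*} [TopologicalSpace M]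
  [ChartedSpace (EuclideanSpace ℝ (Fin n)) M] [IsManifold (𝓡 n) ∞ M]
  {η : OneForm n M} {h : M → Circle}

/-- If `r` is a smooth retraction onto the fibre `h = z` near a point `p` of this fibre, then
`(h, r)` is a local diffeomorphism at `p`: in a foliated chart around `p = (u₀, t₀)` it has the form
`(u, t) ↦ (H₁ (u, t), t)` with `H₁ (u, t₀) = u`. -/
lemma OneForm.IsPhase.exists_openPartialHomeomorph_retraction (hh : η.IsPhase h) {z : Circle}
    (hF : η.IsSlice h (h ⁻¹' {z})) {ρ : M → M} (hρ : ∀ x, h x = z → ρ x = x)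
    {r : M → Slice hF} (hr : ∀ m, h (ρ m) = z → Slice.incl hF (r m) = ρ m) (p : Slice hF)
    (hρs : ∀ᶠ m in 𝓝 (Slice.incl hF p), ContMDiffAt (𝓡 n) (𝓡 n) ∞ ρ m ∧ h (ρ m) = z) :
    ∃ Ψ : OpenPartialHomeomorph M (Circle × Slice hF), Slice.incl hF p ∈ Ψ.source ∧
      (∀ m ∈ Ψ.source, Ψ m = (h m, r m)) ∧
      ContMDiffOn (𝓡 n) ((𝓡 1).prod (𝓡 (n - 1))) ∞ (fun m => (h m, r m)) Ψ.source ∧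
      ContMDiffOn ((𝓡 1).prod (𝓡 (n - 1))) (𝓡 n) ∞ Ψ.symm Ψ.target := by
  set x := Slice.incl hF p with hx
  have hxz : h x = z := Slice.incl_mem p
  set ψ := Slice.foliatedChart p with hψdef
  have hψ : η.IsFoliatedChart h ψ := Slice.isFoliatedChart p
  have hxψ : x ∈ ψ.source := Slice.mem_foliatedChart_source p
  have hρx : ∀ᶠ m in 𝓝 x, ρ m ∈ ψ.source :=
    hρs.self_of_nhds.1.continuousAt.preimage_mem_nhds
      (ψ.open_source.mem_nhds (by rwa [hρ x hxz]))
  obtain ⟨U, hU, hUo, hxU⟩ := eventually_nhds_iff.1 (hρs.and hρx)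
  let O := ψ.target ∩ ψ.symm ⁻¹' U
  have hO : IsOpen O := ψ.isOpen_inter_preimage_symm hUo
  have hxO : ψ x ∈ O := ⟨ψ.map_source hxψ, by rwa [mem_preimage, ψ.left_inv hxψ]⟩
  let H₁ : EuclideanSpace ℝ (Fin (n - 1)) × ℝ → EuclideanSpace ℝ (Fin (n - 1)) :=
    fun y => (ψ (ρ (ψ.symm y))).1
  let H : EuclideanSpace ℝ (Fin (n - 1)) × ℝ → EuclideanSpace ℝ (Fin (n - 1)) × ℝ :=
    fun y => (H₁ y, y.2)
  have hH₁ : ContDiffOn ℝ ∞ H₁ O := by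
    rw [← contMDiffOn_iff_contDiffOn]
    intro y hy
    have h1 := (hψ.contMDiffAt (hU _ hy.2).2).comp y
      ((hU _ hy.2).1.1.comp y (hψ.contMDiffAt_symm hy.1))
    exact (contDiff_fst.contMDiff.contMDiffAt.comp y h1).contMDiffWithinAt
  have hH : ContDiffOn ℝ ∞ H O := hH₁.prodMk contDiffOn_snd
  have hH₁d : HasFDerivAt H₁ (fderiv ℝ H₁ (ψ x)) (ψ x) :=
    ((hH₁.contDiffAt (hO.mem_nhds hxO)).differentiableAt (by simp)).hasFDerivAt
  have hHd : HasFDerivAt H ((fderiv ℝ H₁ (ψ x)).prod (ContinuousLinearMap.snd ℝ _ _)) (ψ x) :=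
    hH₁d.prodMk hasFDerivAt_snd
  -- `H₁` is the identity along the plaque through `x`.
  have hD : ∀ v, fderiv ℝ H₁ (ψ x) (v, 0) = v := by
    have h1 : HasFDerivAt (fun u : EuclideanSpace ℝ (Fin (n - 1)) => (u, (ψ x).2))
        (ContinuousLinearMap.inl ℝ _ ℝ) (ψ x).1 := hasFDerivAt_prodMk_left _ _
    have h2 : HasFDerivAt (H₁ ∘ fun u => (u, (ψ x).2)) _ (ψ x).1 := hH₁d.comp (ψ x).1 h1
    have h3 : (H₁ ∘ fun u => (u, (ψ x).2)) =ᶠ[𝓝 (ψ x).1] id := by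
      have h4 : ContinuousAt (fun u : EuclideanSpace ℝ (Fin (n - 1)) => (u, (ψ x).2)) (ψ x).1 := by
        fun_prop
      filter_upwards [h4.preimage_mem_nhds (hO.mem_nhds hxO)] with u hu
      have h5 : h (ψ.symm (u, (ψ x).2)) = z := by
        rw [← hxz, hψ.eq_iff_snd_eq (ψ.map_target hu.1) hxψ, ψ.right_inv hu.1]
      simp only [H₁, Function.comp_apply, id]
      rw [hρ _ h5, ψ.right_inv hu.1]
    intro v
    have h6 := DFunLike.congr_fun (h2.unique ((hasFDerivAt_id _).congr_of_eventuallyEq h3)) v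
    exact h6
  have hinj : Function.Injective ((fderiv ℝ H₁ (ψ x)).prod (ContinuousLinearMap.snd ℝ
      (EuclideanSpace ℝ (Fin (n - 1))) ℝ)) := by
    refine (injective_iff_map_eq_zero _).2 ?_
    rintro ⟨v, t⟩ hv
    obtain ⟨h1, h2⟩ := Prod.ext_iff.1 hv
    have h3 : t = 0 := h2
    subst h3
    exact Prod.ext ((hD v).symm.trans h1) rfl
  obtain ⟨D, hDe⟩ : ∃ D : (EuclideanSpace ℝ (Fin (n - 1)) × ℝ) ≃L[ℝ]
      (EuclideanSpace ℝ (Fin (n - 1)) × ℝ), (D : _ →L[ℝ] _) =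
        (fderiv ℝ H₁ (ψ x)).prod (ContinuousLinearMap.snd ℝ _ _) :=
    ⟨(LinearEquiv.ofInjectiveEndo _ hinj).toContinuousLinearEquiv,
      ContinuousLinearMap.ext fun _ => rfl⟩
  rw [← hDe] at hHd
  obtain ⟨Θ, hxΘ, hΘO, hΘ, hΘs⟩ := exists_openPartialHomeomorph_of_hasFDerivAt hO hH hxO hHd
  obtain ⟨α, hzα, hαs, hαe, hαc⟩ := Circle.exists_openPartialHomeomorph_angle (ψ x).2
  let C := chartAt (EuclideanSpace ℝ (Fin (n - 1))) p
  let κ : OpenPartialHomeomorph (Circle × Slice hF) (EuclideanSpace ℝ (Fin (n - 1)) × ℝ) :=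
    (α.prod C).transHomeomorph (Homeomorph.prodComm _ _)
  have hκs : ∀ y, κ.symm y = (Circle.exp y.2, C.symm y.1) := fun y => Prod.ext (hαs _) rfl
  have hκc : ContMDiffOn ((𝓡 1).prod (𝓡 (n - 1))) 𝓘(ℝ, EuclideanSpace ℝ (Fin (n - 1)) × ℝ) ∞
      κ κ.source := by
    rintro ⟨w, q⟩ hwq
    have h1 : w ∈ α.source := hwq.1
    have h2 : q ∈ C.source := hwq.2
    have h3 := (hαc.contMDiffAt (α.open_source.mem_nhds h1)).comp (w, q)
      (contMDiffAt_fst (I := 𝓡 1) (J := 𝓡 (n - 1)))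
    have h4 := ((contMDiffOn_chart (n := ∞) (I := 𝓡 (n - 1)) (x := p)).contMDiffAt
      (C.open_source.mem_nhds h2)).comp (w, q) (contMDiffAt_snd (I := 𝓡 1) (J := 𝓡 (n - 1)))
    exact (h4.prodMk_space h3).contMDiffWithinAt
  have hCr : ∀ m ∈ U, r m ∈ C.source ∧ C (r m) = (ψ (ρ m)).1 := by
    intro m hm
    have h1 := hr m (hU m hm).1.2
    have h2 : r m ∈ Slice.incl hF ⁻¹' ψ.source := by
      rw [mem_preimage, h1]
      exact (hU m hm).2
    exact ⟨h2, congrArg (fun y => (ψ y).1) h1⟩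
  let Ψ := ψ ≫ₕ (Θ ≫ₕ κ.symm)
  have hsource : ∀ m ∈ Ψ.source, m ∈ ψ.source ∧ ψ m ∈ Θ.source ∧ m ∈ U := by
    intro m hm
    have h1 : m ∈ ψ.source ∧ ψ m ∈ Θ.source := ⟨hm.1, hm.2.1⟩
    refine ⟨h1.1, h1.2, ?_⟩
    have := (hΘO h1.2).2
    rwa [mem_preimage, ψ.left_inv h1.1] at this
  refine ⟨Ψ, ⟨hxψ, hxΘ, ?_⟩, fun m hm => ?_, fun m hm => ?_, fun q hq => ?_⟩
  · have h1 : Θ (ψ x) = ψ x := by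
      rw [hΘ]
      refine Prod.ext ?_ rfl
      simp only [H, H₁]
      rw [ψ.left_inv hxψ, hρ x hxz]
    change Θ (ψ x) ∈ κ.target
    rw [h1]
    have h2 : (α.prod C) (Circle.exp (ψ x).2, p) ∈ (α.prod C).target :=
      (α.prod C).map_source ⟨hzα, mem_chart_source _ p⟩
    have h3 : (α.prod C) (Circle.exp (ψ x).2, p) = ((ψ x).2, (ψ x).1) := by
      refine Prod.ext ?_ rfl
      change α (Circle.exp (ψ x).2) = _
      rw [hαe _ hzα, Circle.angle_self, add_zero]
    rw [h3] at h2
    exact h2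
  · obtain ⟨h1, h2, h3⟩ := hsource m hm
    change κ.symm (Θ (ψ m)) = _
    rw [hΘ, hκs]
    refine Prod.ext (hψ.eq_exp m h1).symm ?_
    simp only [H, H₁]
    rw [ψ.left_inv h1, ← (hCr m h3).2, C.left_inv (hCr m h3).1]
  · obtain ⟨h1, h2, h3⟩ := hsource m hm
    refine (hh.contMDiff m).contMDiffWithinAt.prodMk (Slice.contMDiffWithinAt_of_incl ?_)
    refine ((hU m h3).1.1.congr_of_eventuallyEq ?_).contMDiffWithinAt
    filter_upwards [hUo.mem_nhds h3] with m' hm' using hr m' (hU m' hm').1.2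
  · have h1 : q ∈ κ.source ∧ κ q ∈ Θ.target ∧ Θ.symm (κ q) ∈ ψ.target := by
      exact ⟨hq.1.1, hq.1.2, hq.2⟩
    exact ((hψ.contMDiffAt_symm h1.2.2).comp q
      (((hΘs.contDiffAt (Θ.open_target.mem_nhds h1.2.1)).contMDiffAt).comp q
        (hκc.contMDiffAt (κ.open_source.mem_nhds h1.1)))).contMDiffWithinAt

end Trivialization

/-! ### Local triviality of a phase -/

section LocalTriviality

open Filter Topology

/-- A topological tube lemma: if `(h, r)` is a local homeomorphism along the compact fibre
`h = z`, on which `r` is a retraction, then it is a trivialization of `h` over a neighbourhood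
of `z`. -/
lemma exists_trivialization_of_retraction {M B F : Type*} [TopologicalSpace M] [CompactSpace M]
    [Nonempty M] [TopologicalSpace B] [T2Space B] [TopologicalSpace F] [T2Space F] [CompactSpace F]
    {h : M → B} (hc : Continuous h) {z : B} {i : F → M} (hi : Continuous i)
    (hiz : range i = h ⁻¹' {z}) {r : M → F} (hr : ∀ p, r (i p) = p)
    (Ψ : F → OpenPartialHomeomorph M (B × F)) (hΨi : ∀ p, i p ∈ (Ψ p).source)
    (hΨ : ∀ p, ∀ m ∈ (Ψ p).source, Ψ p m = (h m, r m)) :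
    ∃ e : Trivialization F h, z ∈ e.baseSet ∧ (∀ m, e m = (h m, r m)) ∧
      (∀ m ∈ e.source, ∃ p, m ∈ (Ψ p).source) ∧
      ∀ q ∈ e.target, ∃ p, q ∈ (Ψ p).target ∧
        ∀ᶠ q' in 𝓝 q, e.toOpenPartialHomeomorph.symm q' = (Ψ p).symm q' := by
  set G : M → B × F := fun m => (h m, r m) with hG
  have hGc : ∀ p, ∀ m ∈ (Ψ p).source, ContinuousAt G m := fun p m hm =>
    ((Ψ p).continuousAt hm).congr
      (((Ψ p).open_source.eventually_mem hm).mono fun m' hm' => hΨ p m' hm')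
  have hfib : ∀ x, h x = z → ∃ p, i p = x := fun x hx => by
    have : x ∈ range i := hiz ▸ hx
    exact this
  have hiz' : ∀ p, h (i p) = z := fun p => by
    have : i p ∈ h ⁻¹' {z} := hiz ▸ mem_range_self p
    exact this
  have hinj : InjOn G (range i) := by
    rintro _ ⟨p, rfl⟩ _ ⟨q, rfl⟩ hpq
    have := (Prod.ext_iff.1 hpq).2
    simp only [hG, hr] at this
    rw [this]
  obtain ⟨V, hV, hVinj⟩ := hinj.exists_mem_nhdsSet (isCompact_range hi)
    (by rintro _ ⟨p, rfl⟩; exact hGc p _ (hΨi p))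
    (by
      rintro _ ⟨p, rfl⟩
      refine ⟨_, (Ψ p).open_source.mem_nhds (hΨi p), fun x hx y hy hxy => ?_⟩
      exact (Ψ p).injOn hx hy (by rw [hΨ p x hx, hΨ p y hy]; exact hxy))
  set W : Set M := interior V ∩ ⋃ p, (Ψ p).source with hW
  have hWo : IsOpen W := isOpen_interior.inter (isOpen_iUnion fun p => (Ψ p).open_source)
  have hWs : ∀ m ∈ W, ∃ p, m ∈ (Ψ p).source := fun m hm => mem_iUnion.1 hm.2
  have hiW : ∀ p, i p ∈ W := fun p =>
    ⟨subset_interior_iff_mem_nhdsSet.2 hV (mem_range_self p), mem_iUnion.2 ⟨p, hΨi p⟩⟩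
  have hWinj : InjOn G W := hVinj.mono fun m hm => interior_subset hm.1
  have hGo : ∀ O ⊆ W, IsOpen O → IsOpen (G '' O) := by
    intro O hOW hO
    rw [isOpen_iff_mem_nhds]
    rintro _ ⟨m, hm, rfl⟩
    obtain ⟨p, hp⟩ := hWs m (hOW hm)
    have h1 : Ψ p '' ((Ψ p).source ∩ O) ∈ 𝓝 (G m) := by
      have := ((Ψ p).isOpen_image_source_inter hO).mem_nhds (mem_image_of_mem _ ⟨hp, hm⟩)
      rwa [hΨ p m hp] at this
    refine mem_of_superset h1 ?_
    rintro _ ⟨m', hm', rfl⟩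
    exact ⟨m', hm'.2, (hΨ p m' hm'.1).symm⟩
  obtain ⟨A₁, A₂, hA₁, -, hzA₁, hA₂, hAG⟩ := generalized_tube_lemma (isCompact_singleton (x := z))
    (isCompact_univ (X := F)) (hGo W le_rfl hWo) (by
      rintro ⟨w, p⟩ ⟨hw, -⟩
      refine ⟨i p, hiW p, ?_⟩
      simp only [hG, hr, hiz']
      exact Prod.ext hw.symm rfl)
  have hA₀ : IsOpen (h '' Wᶜ)ᶜ := (hc.isClosedMap _ hWo.isClosed_compl).isOpen_compl
  set A : Set B := (h '' Wᶜ)ᶜ ∩ A₁ with hA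
  have hAo : IsOpen A := hA₀.inter hA₁
  have hAW : ∀ m, h m ∈ A → m ∈ W := fun m hm => by
    by_contra hmW
    exact hm.1 ⟨m, hmW, rfl⟩
  have hzA : z ∈ A := by
    refine ⟨?_, hzA₁ rfl⟩
    rintro ⟨m, hm, hmz⟩
    obtain ⟨p, rfl⟩ := hfib m hmz
    exact hm (hiW p)
  set K := Function.invFunOn G W with hK
  have hKG : ∀ q ∈ A ×ˢ (univ : Set F), K q ∈ W ∧ G (K q) = q := by
    rintro ⟨w, p⟩ ⟨hw, -⟩
    have : (w, p) ∈ G '' W := hAG ⟨hw.2, hA₂ (mem_univ p)⟩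
    exact ⟨Function.invFunOn_mem this, Function.invFunOn_eq this⟩
  have hGK : ∀ m, h m ∈ A → K (G m) = m := fun m hm => hWinj.leftInvOn_invFunOn (hAW m hm)
  have hKh : ∀ q ∈ A ×ˢ (univ : Set F), h (K q) = q.1 := fun q hq =>
    congrArg Prod.fst (hKG q hq).2
  have hAuo : IsOpen (A ×ˢ (univ : Set F)) := hAo.prod isOpen_univ
  -- The global inverse agrees locally with the local inverses.
  have hKloc : ∀ q ∈ A ×ˢ (univ : Set F), ∃ p, q ∈ (Ψ p).target ∧
      ∀ᶠ q' in 𝓝 q, K q' = (Ψ p).symm q' := by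
    intro q hq
    obtain ⟨p, hp⟩ := hWs _ (hKG q hq).1
    have h1 : Ψ p (K q) = q := (hΨ p _ hp).trans (hKG q hq).2
    have h2 : q ∈ (Ψ p).target := h1 ▸ (Ψ p).map_source hp
    have h3 : (Ψ p).symm q = K q := by rw [← h1, (Ψ p).left_inv hp, h1]
    refine ⟨p, h2, ?_⟩
    have h4 : ∀ᶠ q' in 𝓝 q, (Ψ p).symm q' ∈ W :=
      ((Ψ p).continuousAt_symm h2).preimage_mem_nhds
        (hWo.mem_nhds (by rw [h3]; exact (hKG q hq).1))
    filter_upwards [h4, (Ψ p).open_target.mem_nhds h2, hAuo.mem_nhds hq] with q' h5 h6 h7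
    refine hWinj (hKG q' h7).1 h5 ?_
    exact (hKG q' h7).2.trans (((Ψ p).right_inv h6).symm.trans (hΨ p _ ((Ψ p).map_target h6)))
  refine ⟨{
    toFun := G
    invFun := K
    source := h ⁻¹' A
    target := A ×ˢ univ
    map_source' := fun m hm => ⟨hm, mem_univ _⟩
    map_target' := fun q hq => by
      rw [mem_preimage, hKh q hq]
      exact hq.1
    left_inv' := fun m hm => hGK m hm
    right_inv' := fun q hq => (hKG q hq).2
    open_source := hAo.preimage hc
    open_target := hAuo
    continuousOn_toFun := fun m hm => by
      obtain ⟨p, hp⟩ := hWs m (hAW m hm)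
      exact (hGc p m hp).continuousWithinAt
    continuousOn_invFun := fun q hq => by
      obtain ⟨p, hp, hpe⟩ := hKloc q hq
      exact (((Ψ p).continuousAt_symm hp).congr
        (hpe.mono fun _ h => h.symm)).continuousWithinAt
    baseSet := A
    open_baseSet := hAo
    source_eq := rfl
    target_eq := rfl
    proj_toFun := fun _ _ => rfl }, hzA, fun _ => rfl, fun m hm => hWs m (hAW m hm), hKloc⟩

variable {n : ℕ} {M : Type*} [TopologicalSpace M]
  [ChartedSpace (EuclideanSpace ℝ (Fin n)) M] [IsManifold (𝓡 n) ∞ M]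
  {η : OneForm n M} {h : M → Circle}

/-- A trivialization of a map to the circle which is a diffeomorphism. -/
def Bundle.Trivialization.IsSmooth (n : ℕ) {M F : Type*} [TopologicalSpace M]
    [ChartedSpace (EuclideanSpace ℝ (Fin n)) M] [TopologicalSpace F]
    [ChartedSpace (EuclideanSpace ℝ (Fin (n - 1))) F] {h : M → Circle}
    (e : Trivialization F h) : Prop :=
  ContMDiffOn (𝓡 n) ((𝓡 1).prod (𝓡 (n - 1))) ∞ e e.source ∧
    ContMDiffOn ((𝓡 1).prod (𝓡 (n - 1))) (𝓡 n) ∞ e.toOpenPartialHomeomorph.symm e.target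

lemma Slice.compactSpace_fiber [CompactSpace M] (hh : η.IsPhase h) {z : Circle}
    (hF : η.IsSlice h (h ⁻¹' {z})) : CompactSpace (Slice hF) :=
  isCompact_iff_compactSpace.1 ((isClosed_singleton.preimage hh.contMDiff.continuous).isCompact)

/-- Local triviality (the compact case of Ehresmann's theorem): a phase is trivial near each point
of the circle. -/
theorem OneForm.IsPhase.exists_trivialization [T2Space M] [CompactSpace M] [Nonempty M]
    (hh : η.IsPhase h) (hvanish : η.IsNowhereVanishing) (z : Circle) :
    ∃ e : Trivialization (Slice (hh.isSlice_fiber hvanish z)) h, z ∈ e.baseSet ∧ e.IsSmooth n := by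
  classical
  set hF := hh.isSlice_fiber hvanish z
  obtain ⟨ρ, hρ, hρs⟩ := hh.exists_retraction hvanish z
  obtain ⟨x₀, hx₀⟩ := hh.surjective hvanish z
  let r : M → Slice hF := fun m =>
    if hm : h (ρ m) = z then Slice.mk (ρ m) hm else Slice.mk x₀ hx₀
  have hr : ∀ m, h (ρ m) = z → Slice.incl hF (r m) = ρ m := fun m hm => by
    simp only [r, dif_pos hm]
    rfl
  have hri : ∀ p, r (Slice.incl hF p) = p := fun p => by
    have h1 : ρ (Slice.incl hF p) = Slice.incl hF p := hρ _ (Slice.incl_mem p)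
    have h2 : h (Slice.incl hF p) = z := Slice.incl_mem p
    refine (Slice.isEmbedding_incl (hS := hF)).injective ?_
    rw [hr _ (by rw [h1, h2]), h1]
  choose Ψ hΨi hΨ hΨs hΨs' using fun p : Slice hF =>
    hh.exists_openPartialHomeomorph_retraction hF hρ hr p (hρs _ (Slice.incl_mem p))
  have := Slice.compactSpace_fiber hh hF
  obtain ⟨e, hz, he, hes, het⟩ := exists_trivialization_of_retraction hh.contMDiff.continuous
    Slice.isEmbedding_incl.continuous (Slice.range_incl hF) hri Ψ hΨi hΨ
  refine ⟨e, hz, fun m hm => ?_, fun q hq => ?_⟩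
  · obtain ⟨p, hp⟩ := hes m hm
    exact (((hΨs p).contMDiffAt ((Ψ p).open_source.mem_nhds hp)).congr_of_eventuallyEq
      (.of_forall he)).contMDiffWithinAt
  · obtain ⟨p, hp, hpe⟩ := het q hq
    exact (((hΨs' p).contMDiffAt ((Ψ p).open_target.mem_nhds hp)).congr_of_eventuallyEq
      hpe).contMDiffWithinAt

/-- The changes of fibre coordinates between two trivializations, possibly with different fibres,
are inverse to each other. -/
lemma Bundle.Trivialization.snd_symm_snd_symm {B Z F F' : Type*} [TopologicalSpace B]
    [TopologicalSpace Z] [TopologicalSpace F] [TopologicalSpace F'] {h : Z → B}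
    (e : Trivialization F h) (e' : Trivialization F' h) {v : B} (hv : v ∈ e.baseSet)
    (hv' : v ∈ e'.baseSet) (x : F) : (e (e'.toOpenPartialHomeomorph.symm
      (v, (e' (e.toOpenPartialHomeomorph.symm (v, x))).2))).2 = x := by
  have h3 : (v, x) ∈ e.target := by simp [e.mem_target, hv]
  have h4 : e.toOpenPartialHomeomorph.symm (v, x) ∈ e'.source := by
    rw [e'.mem_source, e.proj_symm_apply h3]
    exact hv'
  have h5 : (v, (e' (e.toOpenPartialHomeomorph.symm (v, x))).2) =
      e' (e.toOpenPartialHomeomorph.symm (v, x)) :=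
    Prod.ext ((e.proj_symm_apply h3).symm.trans (e'.coe_fst h4).symm) rfl
  rw [h5, ← e'.coe_coe, e'.left_inv h4, ← e.coe_coe, e.right_inv h3]

lemma Bundle.Trivialization.IsSmooth.contMDiff_coordChange {F F' : Type*} [TopologicalSpace F]
    [ChartedSpace (EuclideanSpace ℝ (Fin (n - 1))) F] [TopologicalSpace F']
    [ChartedSpace (EuclideanSpace ℝ (Fin (n - 1))) F']
    {e : Trivialization F h} (he : e.IsSmooth n) {e' : Trivialization F' h} (he' : e'.IsSmooth n)
    {v : Circle} (hv : v ∈ e.baseSet) (hv' : v ∈ e'.baseSet) :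
    ContMDiff (𝓡 (n - 1)) (𝓡 (n - 1)) ∞
      fun x => (e' (e.toOpenPartialHomeomorph.symm (v, x))).2 := by
  intro x
  have h3 : (v, x) ∈ e.target := by simp [e.mem_target, hv]
  have h4 : e.toOpenPartialHomeomorph.symm (v, x) ∈ e'.source := by
    rw [e'.mem_source, e.proj_symm_apply h3]
    exact hv'
  have h5 := (he.2.contMDiffAt (e.open_target.mem_nhds h3)).comp x
    ((contMDiffAt_const (c := v) (I' := 𝓡 1)).prodMk (contMDiffAt_id (I := 𝓡 (n - 1)) (x := x)))
  exact contMDiffAt_snd.comp x ((he'.1.contMDiffAt (e'.open_source.mem_nhds h4)).comp x h5)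

/-- If the base sets of two smooth trivializations meet, then their fibres are diffeomorphic, and
so the fibre of one of them can be replaced by that of the other. -/
lemma Bundle.Trivialization.IsSmooth.exists_transfer {F F' : Type*} [TopologicalSpace F]
    [ChartedSpace (EuclideanSpace ℝ (Fin (n - 1))) F] [TopologicalSpace F']
    [ChartedSpace (EuclideanSpace ℝ (Fin (n - 1))) F']
    {e : Trivialization F h} (he : e.IsSmooth n) {e' : Trivialization F' h} (he' : e'.IsSmooth n)
    {v : Circle} (hv : v ∈ e.baseSet) (hv' : v ∈ e'.baseSet) :
    ∃ e'' : Trivialization F' h, e''.baseSet = e.baseSet ∧ e''.IsSmooth n := by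
  have hφ := he.contMDiff_coordChange he' hv hv'
  have hφ' := he'.contMDiff_coordChange he hv' hv
  let φ : F ≃ₜ F' :=
    { toFun := fun x => (e' (e.toOpenPartialHomeomorph.symm (v, x))).2
      invFun := fun x => (e (e'.toOpenPartialHomeomorph.symm (v, x))).2
      left_inv := e.snd_symm_snd_symm e' hv hv'
      right_inv := e'.snd_symm_snd_symm e hv' hv
      continuous_toFun := hφ.continuous
      continuous_invFun := hφ'.continuous }
  refine ⟨e.transFiberHomeomorph φ, rfl, fun m hm => ?_, fun q hq => ?_⟩
  · have h1 := he.1.contMDiffAt (e.open_source.mem_nhds hm)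
    exact ((contMDiffAt_fst.comp m h1).prodMk
      ((hφ _).comp m (contMDiffAt_snd.comp m h1))).contMDiffWithinAt
  · have hq' : (q.1, φ.symm q.2) ∈ e.target := by
      rw [e.mem_target]
      exact ((e.transFiberHomeomorph φ).mem_target).1 hq
    have h1 : ContMDiffAt ((𝓡 1).prod (𝓡 (n - 1))) ((𝓡 1).prod (𝓡 (n - 1))) ∞
        (fun q : Circle × F' => (q.1, φ.symm q.2)) q :=
      contMDiffAt_fst.prodMk ((hφ' q.2).comp q contMDiffAt_snd)
    exact ((he.2.contMDiffAt (e.open_target.mem_nhds hq')).comp q h1).contMDiffWithinAt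

/-- A phase on a nonempty compact manifold is a smooth fibration. The fibres over all points of the
circle are diffeomorphic as the circle is connected. -/
theorem OneForm.IsPhase.isSmoothCircleFibration {M : Type u} [TopologicalSpace M]
    [ChartedSpace (EuclideanSpace ℝ (Fin n)) M] [IsManifold (𝓡 n) ∞ M] {η : OneForm n M}
    {h : M → Circle} [T2Space M] [CompactSpace M] [Nonempty M]
    (hh : η.IsPhase h) (hvanish : η.IsNowhereVanishing) : IsSmoothCircleFibration n h := by
  refine ⟨hh.contMDiff, Slice (hh.isSlice_fiber hvanish 1), inferInstance, inferInstance,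
    inferInstance, ?_⟩
  set T : Set Circle := {w | ∃ e : Trivialization (Slice (hh.isSlice_fiber hvanish 1)) h,
    w ∈ e.baseSet ∧ e.IsSmooth n} with hT
  have hTo : IsOpen T := isOpen_iff_mem_nhds.2 fun w ⟨e, hw, he⟩ =>
    mem_of_superset (e.open_baseSet.mem_nhds hw) fun w' hw' => ⟨e, hw', he⟩
  have hTc : _root_.IsClosed T := by
    refine isClosed_of_closure_subset fun w hw => ?_
    obtain ⟨e, hwe, he⟩ := hh.exists_trivialization hvanish w
    obtain ⟨v, hve, e', hv', he'⟩ := mem_closure_iff.1 hw _ e.open_baseSet hwe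
    obtain ⟨e'', hb, he''⟩ := he.exists_transfer he' hve hv'
    exact ⟨e'', hb ▸ hwe, he''⟩
  have hTu : T = univ :=
    IsClopen.eq_univ ⟨hTc, hTo⟩ ⟨1, hh.exists_trivialization hvanish 1⟩
  intro z
  have hz : z ∈ T := hTu ▸ mem_univ z
  exact hz

end LocalTriviality

/-! ### Compact coverings of the circle -/

section CircleCovering

open Filter Topology

variable {L : Type*} [TopologicalSpace L] {p : L → Circle}

lemma IsCoveringMap.exists_lift_circleExp (hp : IsCoveringMap p) {s : ℝ} {ℓ : L}
    (hs : p ℓ = Circle.exp s) :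
    ∃ τ : ℝ → L, Continuous τ ∧ τ s = ℓ ∧ ∀ t, p (τ t) = Circle.exp t := by
  obtain ⟨τ, ⟨h1, h2⟩, -⟩ := hp.existsUnique_continuousMap_lifts Circle.exp s ℓ hs
  exact ⟨τ, τ.continuous, h1, fun t => congrFun h2 t⟩

/-- Two lifts of `exp : ℝ → S¹` which have a value in common are translates of each other. -/
lemma IsCoveringMap.lift_circleExp_unique (hp : IsCoveringMap p) {τ τ' : ℝ → L}
    (hτ : Continuous τ) (hpτ : ∀ t, p (τ t) = Circle.exp t) (hτ' : Continuous τ')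
    (hpτ' : ∀ t, p (τ' t) = Circle.exp t) {a b : ℝ} (hab : τ a = τ' b) (t : ℝ) :
    τ (t + a) = τ' (t + b) := by
  have h1 : Circle.exp a = Circle.exp b := by rw [← hpτ, ← hpτ', hab]
  refine congrFun (hp.eq_of_comp_eq (g₁ := fun t => τ (t + a)) (g₂ := fun t => τ' (t + b))
    (by fun_prop) (by fun_prop) (funext fun t => ?_) 0 (by simpa using hab)) t
  simp [hpτ, hpτ', Circle.exp_add, h1]

/-- A compact connected covering space of the circle is a circle: a lift `τ` of `exp : ℝ → S¹`
is onto and identifies it with `ℝ / cℤ` for some `c ≠ 0`. -/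
theorem IsCoveringMap.exists_circle_parametrization [CompactSpace L] [ConnectedSpace L]
    (hp : IsCoveringMap p) :
    ∃ (τ : ℝ → L) (c : ℝ), Continuous τ ∧ c ≠ 0 ∧ Function.Surjective τ ∧
      (∀ t, p (τ t) = Circle.exp t) ∧ ∀ a b, τ a = τ b ↔ ∃ k : ℤ, b - a = k * c := by
  obtain ⟨ℓ₀⟩ := (inferInstance : Nonempty L)
  obtain ⟨s₀, hs₀⟩ := Circle.exp_surjective (p ℓ₀)
  obtain ⟨τ, hτ, -, hpτ⟩ := hp.exists_lift_circleExp hs₀.symm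
  have hopen : ∀ σ : ℝ → L, Continuous σ → (∀ t, p (σ t) = Circle.exp t) → IsOpenMap σ := by
    intro σ hσ hpσ
    refine (IsLocalHomeomorph.of_comp (f := σ) (g := p) ?_ hp.isLocalHomeomorph hσ).isOpenMap
    rw [show p ∘ σ = Circle.exp from funext hpσ]
    exact isLocalHomeomorph_circleExp
  -- The ranges of the lifts of `exp` are open and partition `L`.
  have hsurj : Function.Surjective τ := by
    rw [← range_eq_univ]
    refine IsClopen.eq_univ ⟨⟨isOpen_iff_mem_nhds.2 fun ℓ hℓ => ?_⟩, (hopen τ hτ hpτ).isOpen_range⟩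
      (range_nonempty τ)
    obtain ⟨s, hs⟩ := Circle.exp_surjective (p ℓ)
    obtain ⟨σ, hσ, hσs, hpσ⟩ := hp.exists_lift_circleExp hs.symm
    refine mem_of_superset ((hopen σ hσ hpσ).isOpen_range.mem_nhds ⟨s, hσs⟩) ?_
    rintro _ ⟨a, rfl⟩ ⟨b, hb⟩
    refine hℓ ⟨(s - a) + b, ?_⟩
    rw [hp.lift_circleExp_unique hτ hpτ hσ hpσ hb, sub_add_cancel, hσs]
  have htrans : ∀ {a b : ℝ}, τ a = τ b → ∀ t, τ (t + a) = τ (t + b) := fun hab =>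
    hp.lift_circleExp_unique hτ hpτ hτ hpτ hab
  let P : AddSubgroup ℝ :=
    { carrier := {d | τ d = τ 0}
      zero_mem' := rfl
      add_mem' := fun {d e} hd he => by
        have := htrans hd e
        rw [add_zero, add_comm] at this
        exact this.trans he
      neg_mem' := fun {d} hd => by
        have := htrans hd (-d)
        rw [neg_add_cancel, add_zero] at this
        exact this.symm }
  have hP : ∀ a b, τ a = τ b ↔ b - a ∈ P := by
    refine fun a b => ⟨fun hab => ?_, fun hd => ?_⟩
    · have := htrans hab (-a)
      rw [neg_add_cancel, neg_add_eq_sub] at this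
      exact this.symm
    · have := htrans (a := b - a) (b := 0) hd a
      rw [add_sub_cancel, add_zero] at this
      exact this.symm
  have hP2 : P ≤ AddSubgroup.zmultiples (2 * Real.pi) := fun d hd => by
    have h1 : Circle.exp d = 1 := by
      rw [← hpτ, show τ d = τ 0 from hd, hpτ, Circle.exp_zero]
    obtain ⟨k, hk⟩ := Circle.exp_eq_one.1 h1
    exact ⟨k, by simp [hk]⟩
  have : IsAddCyclic P := AddSubgroup.isAddCyclic_of_le hP2
  obtain ⟨c, hc⟩ := (AddSubgroup.isAddCyclic_iff_exists_zmultiples_eq_top P).1 this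
  have hmem : ∀ d, d ∈ P ↔ ∃ k : ℤ, d = k * c := fun d => by
    rw [← hc, AddSubgroup.mem_zmultiples_iff]
    simp [eq_comm]
  refine ⟨τ, c, hτ, ?_, hsurj, hpτ, fun a b => by rw [hP, hmem]⟩
  -- Otherwise `L` would be homeomorphic to `ℝ`.
  rintro rfl
  have hinj : Function.Injective τ := fun a b hab => by
    obtain ⟨k, hk⟩ := (hmem _).1 ((hP a b).1 hab)
    rw [mul_zero, sub_eq_zero] at hk
    exact hk.symm
  have e : ℝ ≃ₜ L := (Equiv.ofBijective τ ⟨hinj, hsurj⟩).toHomeomorphOfContinuousOpen hτ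
    (hopen τ hτ hpτ)
  have : CompactSpace ℝ := e.symm.compactSpace
  exact noncompact_univ ℝ isCompact_univ

end CircleCovering

/-! ### The space of components of fibres -/

section LeafSpace

open Filter Topology

/-- The setoid of lying in the same connected component of a fibre of `h`. -/
def fiberComponentSetoid {X Y : Type*} [TopologicalSpace X] (h : X → Y) : Setoid X :=
  Setoid.ker fun x => connectedComponentIn (h ⁻¹' {h x}) x

/-- The space of connected components of fibres of `h`. -/
def FiberComponents {X Y : Type*} [TopologicalSpace X] (h : X → Y) : Type _ :=
  Quotient (fiberComponentSetoid h)

namespace FiberComponents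

variable {X Y : Type*} [TopologicalSpace X] {h : X → Y}

instance : TopologicalSpace (FiberComponents h) :=
  inferInstanceAs (TopologicalSpace (Quotient _))

instance [CompactSpace X] : CompactSpace (FiberComponents h) :=
  inferInstanceAs (CompactSpace (Quotient _))

instance [ConnectedSpace X] : ConnectedSpace (FiberComponents h) :=
  inferInstanceAs (ConnectedSpace (Quotient _))

variable (h) in
/-- The component of the fibre of `h` through a point. -/
def mk (x : X) : FiberComponents h := Quotient.mk (fiberComponentSetoid h) x

lemma mk_eq_mk {x y : X} : mk h x = mk h y ↔
    connectedComponentIn (h ⁻¹' {h x}) x = connectedComponentIn (h ⁻¹' {h y}) y :=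
  Quotient.eq

lemma mk_eq_mk_iff {x y : X} : mk h x = mk h y ↔ y ∈ connectedComponentIn (h ⁻¹' {h x}) x := by
  rw [mk_eq_mk]
  refine ⟨fun hxy => hxy ▸ mem_connectedComponentIn rfl, fun hy => ?_⟩
  have h1 : y ∈ h ⁻¹' {h x} := connectedComponentIn_subset _ _ hy
  have h2 : h y = h x := h1
  rw [h2]
  exact connectedComponentIn_eq hy

lemma isQuotientMap_mk : IsQuotientMap (mk h) := isQuotientMap_quotient_mk'

lemma eq_of_mk_eq {x y : X} (hxy : mk h x = mk h y) : h x = h y := by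
  have h1 : y ∈ h ⁻¹' {h x} := connectedComponentIn_subset _ _ (mk_eq_mk_iff.1 hxy)
  exact Eq.symm h1

/-- The map induced by `h` on the components of its fibres. -/
def proj : FiberComponents h → Y := Quotient.lift h fun _ _ hxy => eq_of_mk_eq (Quotient.sound hxy)

@[simp] lemma proj_mk (x : X) : proj (mk h x) = h x := rfl

variable [TopologicalSpace Y]

/-- Over a trivialization, components of fibres of `h` correspond to components of the model
fibre. -/
lemma mk_eq_mk_iff_trivialization {F : Type*} [TopologicalSpace F]
    (e : Trivialization F h) {x y : X} (hx : h x ∈ e.baseSet) (hxy : h x = h y) :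
    mk h x = mk h y ↔ connectedComponent (e x).2 = connectedComponent (e y).2 := by
  rw [mk_eq_mk_iff, eq_comm (a := connectedComponent (e x).2), connectedComponent_eq_iff_mem]
  have hxs : x ∈ e.source := e.mem_source.2 hx
  have hys : y ∈ e.source := e.mem_source.2 (hxy ▸ hx)
  constructor
  · intro hy
    have h1 : ContinuousOn (fun m => (e m).2) (connectedComponentIn (h ⁻¹' {h x}) x) := by
      refine continuous_snd.comp_continuousOn (e.continuousOn_toFun.mono fun m hm => ?_)
      have h2 : m ∈ h ⁻¹' {h x} := connectedComponentIn_subset _ _ hm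
      have h3 : h m = h x := h2
      rw [e.source_eq, mem_preimage, h3]
      exact hx
    exact (isPreconnected_connectedComponentIn.image _ h1).subset_connectedComponent
      ⟨x, mem_connectedComponentIn rfl, rfl⟩ ⟨y, hy, rfl⟩
  · intro hy
    have h1 : ContinuousOn (fun q => e.toOpenPartialHomeomorph.symm (h x, q))
        (connectedComponent (e x).2) :=
      e.toOpenPartialHomeomorph.continuousOn_symm.comp (t := e.target)
        (f := fun q => (h x, q)) (by fun_prop) fun q _ => by simp [e.mem_target, hx]
    have h2 : ∀ m, h m = h x → e.toOpenPartialHomeomorph.symm (h x, (e m).2) = m := fun m hm => by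
      rw [← hm]
      exact e.symm_apply_mk_proj (e.mem_source.2 (hm ▸ hx))
    refine (isPreconnected_connectedComponent.image _ h1).subset_connectedComponentIn
      ⟨_, mem_connectedComponent, h2 x rfl⟩ ?_ ⟨_, hy, h2 y hxy.symm⟩
    rintro _ ⟨q, -, rfl⟩
    exact e.proj_symm_apply (by simp [e.mem_target, hx])

/-- A component `D` of the model fibre gives an open set of components of fibres of `h`. -/
lemma isOpen_image_mk {F : Type*} [TopologicalSpace F] [LocallyConnectedSpace F]
    (e : Trivialization F h) (f : F) :
    IsOpen (mk h '' {m | m ∈ e.source ∧ (e m).2 ∈ connectedComponent f}) := by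
  have h1 : IsOpen {m | m ∈ e.source ∧ (e m).2 ∈ connectedComponent f} :=
    (continuous_snd.comp_continuousOn e.continuousOn_toFun).isOpen_inter_preimage e.open_source
      isOpen_connectedComponent
  rw [← isQuotientMap_mk.isOpen_preimage]
  convert h1 using 1
  refine Subset.antisymm ?_ (subset_preimage_image _ _)
  rintro m' ⟨m, ⟨hm, hmf⟩, hmm'⟩
  have h2 := eq_of_mk_eq hmm'
  have h3 := (mk_eq_mk_iff_trivialization e (e.mem_source.1 hm) h2).1 hmm'
  refine ⟨e.mem_source.2 (h2 ▸ e.mem_source.1 hm), ?_⟩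
  rw [← connectedComponent_eq_iff_mem] at hmf ⊢
  exact h3.symm.trans hmf

/-- For a locally trivial open map `h` with locally connected fibres, the space of components
of fibres is étale over the base: on the open set given by a component of a model fibre, `proj` is
injective. -/
lemma isLocalHomeomorph_proj (hc : Continuous h) (ho : IsOpenMap h)
    (ht : ∀ z, ∃ (F : Type*) (_ : TopologicalSpace F) (_ : LocallyConnectedSpace F)
      (e : Trivialization F h), z ∈ e.baseSet) :
    IsLocalHomeomorph (proj : FiberComponents h → Y) := by
  rw [isLocalHomeomorph_iff_isOpenEmbedding_restrict]
  intro ℓ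
  obtain ⟨x, rfl⟩ := isQuotientMap_mk.surjective ℓ
  obtain ⟨F, _, _, e, hx⟩ := ht (h x)
  have hpc : Continuous (proj : FiberComponents h → Y) :=
    isQuotientMap_mk.continuous_iff.2 hc
  have hpo : IsOpenMap (proj : FiberComponents h → Y) := by
    intro O hO
    have : proj '' O = h '' (mk h ⁻¹' O) := by
      rw [← image_preimage_eq O isQuotientMap_mk.surjective, image_image,
        image_preimage_eq O isQuotientMap_mk.surjective]
      rfl
    rw [this]
    exact ho _ (hO.preimage isQuotientMap_mk.continuous)
  have hO := isOpen_image_mk e (e x).2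
  refine ⟨_, hO.mem_nhds ⟨x, ⟨e.mem_source.2 hx, mem_connectedComponent⟩, rfl⟩,
    .of_continuous_injective_isOpenMap (hpc.comp continuous_subtype_val) ?_
      (hpo.domRestrict hO)⟩
  rintro ⟨_, m, ⟨hm, hme⟩, rfl⟩ ⟨_, m', ⟨hm', hme'⟩, rfl⟩ hmm'
  refine Subtype.ext ((mk_eq_mk_iff_trivialization e (e.mem_source.1 hm) hmm').2 ?_)
  rw [← connectedComponent_eq_iff_mem] at hme hme'
  exact hme.trans hme'.symm

lemma t2Space [T2Space Y] (hc : Continuous h)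
    (ht : ∀ z, ∃ (F : Type*) (_ : TopologicalSpace F) (_ : LocallyConnectedSpace F)
      (e : Trivialization F h), z ∈ e.baseSet) :
    T2Space (FiberComponents h) := by
  have hpc : Continuous (proj : FiberComponents h → Y) :=
    isQuotientMap_mk.continuous_iff.2 hc
  refine ⟨fun ℓ ℓ' hne => ?_⟩
  by_cases hp : proj ℓ = proj ℓ'
  · obtain ⟨x, rfl⟩ := isQuotientMap_mk.surjective ℓ
    obtain ⟨y, rfl⟩ := isQuotientMap_mk.surjective ℓ'
    have hxy : h x = h y := hp
    obtain ⟨F, _, _, e, hx⟩ := ht (h x)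
    refine ⟨_, _, isOpen_image_mk e (e x).2, isOpen_image_mk e (e y).2,
      ⟨x, ⟨e.mem_source.2 hx, mem_connectedComponent⟩, rfl⟩,
      ⟨y, ⟨e.mem_source.2 (hxy ▸ hx), mem_connectedComponent⟩, rfl⟩, ?_⟩
    rw [disjoint_left]
    rintro _ ⟨m, ⟨hm, hme⟩, rfl⟩ ⟨m', ⟨hm', hme'⟩, hmm'⟩
    rw [← connectedComponent_eq_iff_mem] at hme hme'
    have h1 := (mk_eq_mk_iff_trivialization e (e.mem_source.1 hm') (eq_of_mk_eq hmm')).1 hmm'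
    exact hne ((mk_eq_mk_iff_trivialization e hx hxy).2 (hme.symm.trans (h1.symm.trans hme')))
  · obtain ⟨U, V, hU, hV, h1, h2, h3⟩ := t2_separation hp
    exact ⟨_, _, hU.preimage hpc, hV.preimage hpc, h1, h2, h3.preimage _⟩

end FiberComponents

variable {n : ℕ} {M : Type*} [TopologicalSpace M]
  [ChartedSpace (EuclideanSpace ℝ (Fin n)) M] [IsManifold (𝓡 n) ∞ M]
  {η : OneForm n M} {h : M → Circle}

/-- On a connected manifold, every phase `h` factors through a phase with connected fibres: the
space of components of fibres of `h` is a compact connected covering space of the circle, hence is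
itself a circle. -/
theorem OneForm.IsPhase.exists_isConnected_fiber [T2Space M] [CompactSpace M] [ConnectedSpace M]
    (hh : η.IsPhase h) (hvanish : η.IsNowhereVanishing) :
    ∃ h' : M → Circle, η.IsPhase h' ∧ ∀ z, IsPreconnected (h' ⁻¹' {z}) := by
  have ht : ∀ z, ∃ (F : Type _) (_ : TopologicalSpace F) (_ : LocallyConnectedSpace F)
      (e : Trivialization F h), z ∈ e.baseSet := fun z => by
    obtain ⟨e, hz, -⟩ := hh.exists_trivialization hvanish z
    have : LocallyConnectedSpace (EuclideanSpace ℝ (Fin (n - 1))) :=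
      inferInstance
    exact ⟨_, _, ChartedSpace.locallyConnectedSpace (EuclideanSpace ℝ (Fin (n - 1))) _, e, hz⟩
  have hc := hh.contMDiff.continuous
  have hp := FiberComponents.isLocalHomeomorph_proj hc (hh.isOpenMap hvanish) ht
  have := FiberComponents.t2Space hc ht
  obtain ⟨τ, c, hτ, hc0, hsurj, hpτ, hτc⟩ :=
    (isLocalHomeomorph_iff_isCoveringMap.1 hp).exists_circle_parametrization
  choose t ht using fun x => hsurj (FiberComponents.mk h x)
  have hexp : ∀ {a b : ℝ}, Circle.exp (2 * Real.pi / c * a) = Circle.exp (2 * Real.pi / c * b) ↔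
      τ a = τ b := by
    intro a b
    rw [eq_comm, Circle.exp_eq_exp, hτc]
    refine exists_congr fun k => ?_
    have := Real.pi_ne_zero
    field_simp
    constructor <;> intro h <;> linarith
  refine ⟨fun x => Circle.exp (2 * Real.pi / c * t x), fun x => ?_, fun z => ?_⟩
  · obtain ⟨f, hf⟩ := hh x
    obtain ⟨hfx, hfe, -⟩ := hf.self_of_nhds
    set d := t x - f x with hd
    have hd1 : Circle.exp d = 1 := by
      have h1 : Circle.exp (t x) = Circle.exp (f x) := by
        rw [← hpτ, ht, FiberComponents.proj_mk, hfe]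
      rw [hd, Circle.exp_sub, h1, div_self']
    -- Both sides are lifts of `h` near `x` which agree at `x`.
    have hτf : ∀ᶠ y in 𝓝 x, τ (f y + d) = FiberComponents.mk h y := by
      obtain ⟨U, hU, hxU, hinj⟩ := hp.isLocallyInjective (FiberComponents.mk h x)
      have h1 : ContinuousAt (fun y => τ (f y + d)) x :=
        hτ.continuousAt.comp (hfx.continuousAt.add_const d)
      have h2 : τ (f x + d) = FiberComponents.mk h x := by rw [hd, add_sub_cancel, ht]
      filter_upwards [hf, h1.preimage_mem_nhds (hU.mem_nhds (by rwa [h2])),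
        FiberComponents.isQuotientMap_mk.continuous.continuousAt.preimage_mem_nhds
          (hU.mem_nhds hxU)] with y hy h3 h4
      refine hinj h3 h4 ?_
      rw [hpτ, FiberComponents.proj_mk, Circle.exp_add, hd1, mul_one, hy.2.1]
    refine ⟨fun y => 2 * Real.pi / c * (f y + d), ?_⟩
    filter_upwards [hf, hτf] with y ⟨h1, h2, h3⟩ h4
    refine ⟨?_, ?_, fun v => ?_⟩
    · have h5 : ContDiff ℝ ∞ fun s : ℝ => 2 * Real.pi / c * (s + d) := by fun_prop
      exact h5.contMDiff.contMDiffAt.comp y h1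
    · rw [hexp, ht, h4]
    · have := (h1.mdifferentiableAt (by simp)).hasMFDerivAt.const_mul_add_const
        (2 * Real.pi / c) d v
      have hc1 : 2 * Real.pi / c ≠ 0 := div_ne_zero (by positivity) hc0
      have hmul : ∀ {s : ℝ}, s = 0 ↔ 2 * Real.pi / c * s = 0 := by simp [hc1]
      exact (h3 v).trans (hmul.trans ⟨this.trans, this.symm.trans⟩)
  · refine isPreconnected_of_forall_pair fun x hx y hy => ?_
    have hxy : FiberComponents.mk h x = FiberComponents.mk h y := by
      rw [← ht, ← ht, ← hexp]
      exact Eq.trans hx (Eq.symm hy)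
    refine ⟨connectedComponentIn (h ⁻¹' {h x}) x, fun m hm => ?_, mem_connectedComponentIn rfl,
      FiberComponents.mk_eq_mk_iff.1 hxy, isPreconnected_connectedComponentIn⟩
    have h1 := FiberComponents.mk_eq_mk_iff.2 hm
    refine Eq.trans ?_ hx
    rw [hexp, ht, ht, h1]

end LeafSpace

/-! ### Choice of the fibration -/

section Fibration

variable {n : ℕ} {M : Type u} [TopologicalSpace M]
  [ChartedSpace (EuclideanSpace ℝ (Fin n)) M] [IsManifold (𝓡 n) ∞ M]

/-- The empty map to the circle is a fibration with empty fibre. -/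
lemma isSmoothCircleFibration_of_isEmpty [IsEmpty M] (h : M → Circle) :
    IsSmoothCircleFibration n h := by
  let e : Trivialization PEmpty.{u + 1} h :=
    { toFun := isEmptyElim
      invFun := fun q => isEmptyElim q.2
      source := univ
      target := univ
      map_source' := fun m => isEmptyElim m
      map_target' := fun q => isEmptyElim q.2
      left_inv' := fun m => isEmptyElim m
      right_inv' := fun q => isEmptyElim q.2
      open_source := isOpen_univ
      open_target := isOpen_univ
      continuousOn_toFun := fun m => isEmptyElim m
      continuousOn_invFun := fun q => isEmptyElim q.2
      baseSet := univ
      open_baseSet := isOpen_univ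
      source_eq := rfl
      target_eq := univ_prod_univ.symm
      proj_toFun := fun m => isEmptyElim m }
  let _ : ChartedSpace (EuclideanSpace ℝ (Fin (n - 1))) PEmpty.{u + 1} := ChartedSpace.empty _ _
  exact ⟨fun m => isEmptyElim m, PEmpty, inferInstance, inferInstance, inferInstance,
    fun z => ⟨e, mem_univ z, fun m => isEmptyElim m, fun q => isEmptyElim q.2⟩⟩

/-- On a nonempty compact connected manifold, a phase can be chosen to have connected fibres. -/
lemma OneForm.exists_isPhase_isPreconnected_fiber [T2Space M] [CompactSpace M] [Nonempty M]
    (η : OneForm n M) (hclosed : η.IsClosed) (hvanish : η.IsNowhereVanishing)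
    (hint : η.IsRealMultipleOfIntegralClass) :
    ∃ h : M → Circle, η.IsPhase h ∧ (ConnectedSpace M → ∀ z, IsPreconnected (h ⁻¹' {z})) := by
  obtain ⟨h, hh⟩ := η.exists_isPhase hclosed hvanish hint
  by_cases hM : ConnectedSpace M
  · obtain ⟨h', hh', hc⟩ := hh.exists_isConnected_fiber hvanish
    exact ⟨h', hh', fun _ => hc⟩
  · exact ⟨h, hh, fun hM' => absurd hM' hM⟩

end Fibration

end

theorem mainTheorem7 (n : ℕ) (M : Type u) [TopologicalSpace M] [T2Space M] [CompactSpace M]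
    [ChartedSpace (EuclideanSpace ℝ (Fin n)) M] [IsManifold (𝓡 n) ∞ M]
    (η : OneForm n M) (hclosed : η.IsClosed) (hvanish : η.IsNowhereVanishing)
    (hint : η.IsRealMultipleOfIntegralClass) :
    (∀ (N : Type u) [TopologicalSpace N] [T2Space N] [SecondCountableTopology N]
      [ConnectedSpace N] [ChartedSpace (EuclideanSpace ℝ (Fin (n - 1))) N]
      [IsManifold (𝓡 (n - 1)) ∞ N] (ι : N → M), η.IsLeaf N ι → CompactSpace N) ∧
    ∃ h : M → Circle, IsSmoothCircleFibration n h ∧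
      (∀ S : Set M, η.IsLeafSet S ↔ ∃ x : M, S = connectedComponentIn (h ⁻¹' {h x}) x) ∧
      (ConnectedSpace M → ∀ S : Set M, η.IsLeafSet S ↔ ∃ z : Circle, S = h ⁻¹' {z}) := by
  rcases isEmpty_or_nonempty M with hM | hM
  -- A leaf is nonempty, so the empty manifold has none.
  · refine ⟨fun N _ _ _ _ _ _ ι _ => ?_, fun _ => 1, isSmoothCircleFibration_of_isEmpty _,
      fun S => ⟨?_, fun ⟨x, _⟩ => isEmptyElim x⟩, fun _ => ?_⟩
    · obtain ⟨p⟩ := (inferInstance : Nonempty N)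
      exact isEmptyElim (ι p)
    · rintro ⟨N, _, _, _, _, _, _, ι, -⟩
      obtain ⟨p⟩ := (inferInstance : Nonempty N)
      exact isEmptyElim (ι p)
    · obtain ⟨x⟩ := (inferInstance : Nonempty M)
      exact isEmptyElim x
  obtain ⟨h, hh, hconn⟩ := η.exists_isPhase_isPreconnected_fiber hclosed hvanish hint
  refine ⟨fun N _ _ _ _ _ _ ι hι => hι.compactSpace hh hh.contMDiff.continuous hvanish, h,
    hh.isSmoothCircleFibration hvanish, hh.isLeafSet_iff hvanish, fun hM' S => ?_⟩
  have hfib : ∀ x, connectedComponentIn (h ⁻¹' {h x}) x = h ⁻¹' {h x} := fun x =>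
    (hconn hM' (h x)).connectedComponentIn rfl
  rw [hh.isLeafSet_iff hvanish]
  constructor
  · rintro ⟨x, rfl⟩
    exact ⟨h x, hfib x⟩
  · rintro ⟨z, rfl⟩
    obtain ⟨x, rfl⟩ := hh.surjective hvanish z
    exact ⟨x, (hfib x).symm⟩
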